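/- **Theorem (Geometric Fröhlich Theorem).** Let $M$ be a smooth real Banach manifold (without boundary) and let $K\in C^\infty(M\times M,\mathbb C)$ be a smooth positive definite kernel, i.e. all matrices $(K(x_i,x_j))_{i,j\le n}$ with $x_1,\dots,x_n\in M$ are positive semidefinite. Let $\mathcal H_K\subseteq\mathbb C^M$ be the corresponding reproducing kernel Hilbert space, so that $\varphi(m)=\langle\varphi,K_m\rangle$ for $\varphi\in\mathcal H_K$, $m\in M$ (inner product linear in the first argument), where $K_m(x)=K(x,m)$; let $\mathcal H_K^0=\mathrm{span}\{K_m : m\in M\}$. Then $\mathcal H_K\subseteq C^\infty(M,\mathbb C)$. Let moreover $V$ be a smooth vector field on $M$ with local flow $\Phi^V$, and let $(\mathcal L_V\varphi)(m)=d\varphi(m)(V(m))=\frac{d}{dt}\big|_{t=0}\varphi(\Phi^V_t(m))$ be the Lie derivative on smooth functions. Suppose that $V$ is $K$-symmetric, i.e. $(\mathcal L_VK_m)(n)=\overline{(\mathcal L_VK_n)(m)}$ for all $m,n\in M$. Put $\mathcal D_V=\{\varphi\in\mathcal H_K : \mathcal L_V\varphi\in\mathcal H_K\}$. Then: 1. $\mathcal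 H_K^0\subseteq\mathcal D_V$, and the operator $\mathcal L_V|_{\mathcal H_K^0}:\mathcal H_K^0\to\mathcal H_K$ is essentially self-adjoint, i.e. it is densely defined and symmetric, and its closure $\mathcal L_V^K$ is self-adjoint. 2. $\mathcal L_V^K=\mathcal L_V|_{\mathcal D_V}$, including equality of domains. 3. For $t\in\mathbb R$ let $e^{t\mathcal L_V^K}=\int_{\mathbb R}e^{tr}\,dP(r)$ be the (in general unbounded) self-adjoint operator defined by the spectral measure $P$ of $\mathcal L_V^K$. Whenever the local flow $\Phi^V_t(m)$ of $m\in M$ at time $t\in\mathbb R$ is defined, $K_m$ lies in the domain of $e^{t\mathcal L_V^K}$ and $e^{t\mathcal L_V^K}K_m=K_{\Phi^V_t(m)}$. -/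

import Mathlib

open Set Filter Topology MeasureTheory ComplexConjugate
open scoped Manifold ContDiff InnerProductSpace ComplexOrder

noncomputable section

namespace GeometricFroehlich

/-! ### Positive definite kernels and Lie derivatives on a Banach manifold -/

/-- A kernel is positive definite if all matrices `(K(x i, x j))` attached to finite families of
points are positive semidefinite, that is, Hermitian with nonnegative quadratic form. -/
def IsPositiveDefiniteKernel {M : Type*} (K : M → M → ℂ) : Prop :=
  ∀ (n : ℕ) (x : Fin n → M), (Matrix.of fun i j => K (x i) (x j)).PosSemidef

/-- The element `K_m` of a reproducing kernel Hilbert space of scalar functions: the vector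
representing the evaluation at `m`. -/
def kernelVector {M : Type*} (H : Type*) [NormedAddCommGroup H] [InnerProductSpace ℂ H]
    [CompleteSpace H] [RKHS ℂ H M ℂ] (m : M) : H :=
  RKHS.kerFun H m 1

/-- `H` is the reproducing kernel Hilbert space of the kernel `K`: the representing vectors of the
evaluations are the functions `K_m = K(·, m)`. -/
def HasKernel {M : Type*} (H : Type*) [NormedAddCommGroup H] [InnerProductSpace ℂ H]
    [CompleteSpace H] [RKHS ℂ H M ℂ] (K : M → M → ℂ) : Prop :=
  ∀ m x : M, kernelVector H m x = K x m

/-- The span of the vectors `K_m`. -/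
def kernelSpan {M : Type*} (H : Type*) [NormedAddCommGroup H] [InnerProductSpace ℂ H]
    [CompleteSpace H] [RKHS ℂ H M ℂ] : Submodule ℂ H :=
  Submodule.span ℂ (range fun m : M => kernelVector H m)

section Manifold

variable {E : Type*} [NormedAddCommGroup E] [NormedSpace ℝ E]
  {M : Type*} [TopologicalSpace M] [ChartedSpace E M]

/-- A smooth complex valued function on `M`. -/
abbrev IsSmooth (f : M → ℂ) : Prop := ContMDiff 𝓘(ℝ, E) 𝓘(ℝ, ℂ) ∞ f

/-- The Lie derivative of a function along the vector field `V`, `m ↦ df(m)(V(m))`. -/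
def lieDerivative (V : (m : M) → TangentSpace 𝓘(ℝ, E) m) (f : M → ℂ) (m : M) : ℂ :=
  mfderiv 𝓘(ℝ, E) 𝓘(ℝ, ℂ) f m (V m)

/-- `FlowsTo V t m n` says that the local flow of `V` is defined at `m` at time `t`, with value
`n`: there is an integral curve on an open interval containing `0` and `t` with `γ 0 = m` and
`γ t = n`. -/
def FlowsTo (V : (m : M) → TangentSpace 𝓘(ℝ, E) m) (t : ℝ) (m n : M) : Prop :=
  ∃ (a b : ℝ) (γ : ℝ → M), 0 ∈ Ioo a b ∧ t ∈ Ioo a b ∧ IsMIntegralCurveOn γ V (Ioo a b) ∧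
    γ 0 = m ∧ γ t = n

/-- The Lie derivative is the derivative along the local flow. -/
theorem hasDerivAt_of_integralCurve {V : (m : M) → TangentSpace 𝓘(ℝ, E) m} {f : M → ℂ}
    (hf : IsSmooth (E := E) f) {γ : ℝ → M} {a b : ℝ} (h0 : 0 ∈ Ioo a b)
    (hγ : IsMIntegralCurveOn γ V (Ioo a b)) :
    HasDerivAt (fun t => f (γ t)) (lieDerivative V f (γ 0)) 0 := by
  have h1 := (hγ 0 h0).hasMFDerivAt (Ioo_mem_nhds h0.1 h0.2)
  have h2 := (hf.mdifferentiable (by simp) (γ 0)).hasMFDerivAt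
  let L : ℝ →L[ℝ] ℂ := mfderiv 𝓘(ℝ, E) 𝓘(ℝ, ℂ) f (γ 0) ∘SL (1 : ℝ →L[ℝ] ℝ).smulRight (V (γ 0))
  have h3 : HasFDerivAt (fun t => f (γ t)) L 0 := (h2.comp (0 : ℝ) h1).hasFDerivAt
  have h4 : L 1 = lieDerivative V f (γ 0) := by
    change mfderiv 𝓘(ℝ, E) 𝓘(ℝ, ℂ) f (γ 0) ((1 : ℝ) • V (γ 0)) = _
    rw [one_smul]
    rfl
  exact h4 ▸ h3.hasDerivAt

/-- A vector field is `K`-symmetric if `(L_V K_m)(n) = conj ((L_V K_n)(m))` for all `m`, `n`,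
where `K_m(x) = K(x, m)`. -/
def IsKernelSymmetric (K : M → M → ℂ) (V : (m : M) → TangentSpace 𝓘(ℝ, E) m) : Prop :=
  ∀ m n : M, lieDerivative V (fun x => K x m) n = conj (lieDerivative V (fun x => K x n) m)

theorem lieDerivative_add (V : (m : M) → TangentSpace 𝓘(ℝ, E) m) {f g : M → ℂ}
    (hf : IsSmooth (E := E) f) (hg : IsSmooth (E := E) g) :
    lieDerivative V (f + g) = lieDerivative V f + lieDerivative V g := by
  ext m
  have h1 := (hf.mdifferentiable (by simp) m)
  have h2 := (hg.mdifferentiable (by simp) m)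
  simp only [lieDerivative, Pi.add_apply]
  rw [mfderiv_add h1 h2]
  rfl

theorem lieDerivative_smul (V : (m : M) → TangentSpace 𝓘(ℝ, E) m) {f : M → ℂ}
    (hf : IsSmooth (E := E) f) (c : ℂ) :
    lieDerivative V (c • f) = c • lieDerivative V f := by
  ext m
  have h1 := (hf.mdifferentiable (by simp) m).hasMFDerivAt
  have h2 := ((ContinuousLinearMap.mul ℝ ℂ c).hasMFDerivAt (x := f m)).comp m h1
  have h3 : mfderiv 𝓘(ℝ, E) 𝓘(ℝ, ℂ) (c • f) m = _ := h2.mfderiv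
  simp only [lieDerivative, Pi.smul_apply]
  rw [h3]
  rfl

/-- The Lie derivative as an unbounded operator on `H` with its maximal domain, the set of all
(smooth) `φ` in `H` for which the function `L_V φ` belongs to `H` again. -/
def lieOperator (H : Type*) [NormedAddCommGroup H] [InnerProductSpace ℂ H]
    [RKHS ℂ H M ℂ] (V : (m : M) → TangentSpace 𝓘(ℝ, E) m) : H →ₗ.[ℂ] H where
  domain :=
    { carrier := {φ | IsSmooth (E := E) (φ : M → ℂ) ∧
        ∃ ψ : H, (ψ : M → ℂ) = lieDerivative V (φ : M → ℂ)}
      zero_mem' := by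
        refine ⟨by rw [RKHS.coe_zero]; exact contMDiff_const, 0, ?_⟩
        have := lieDerivative_smul V (f := fun _ : M => (0 : ℂ)) contMDiff_const 0
        simpa using this.symm
      add_mem' := by
        rintro φ φ' ⟨h1, ψ, h2⟩ ⟨h1', ψ', h2'⟩
        refine ⟨by rw [RKHS.coe_add]; exact h1.add h1', ψ + ψ', ?_⟩
        rw [RKHS.coe_add, RKHS.coe_add, lieDerivative_add V h1 h1', h2, h2']
      smul_mem' := by
        rintro c φ ⟨h1, ψ, h2⟩
        refine ⟨?_, c • ψ, ?_⟩
        · rw [RKHS.coe_smul]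
          exact (ContinuousLinearMap.mul ℝ ℂ c).contMDiff.comp h1
        · rw [RKHS.coe_smul, RKHS.coe_smul, lieDerivative_smul V h1, h2] }
  toFun :=
    { toFun := fun φ => φ.2.2.choose
      map_add' := fun φ φ' => DFunLike.coe_injective (by
        rw [RKHS.coe_add, (φ + φ').2.2.choose_spec, φ.2.2.choose_spec, φ'.2.2.choose_spec]
        rw [← lieDerivative_add V φ.2.1 φ'.2.1, ← RKHS.coe_add]
        rfl)
      map_smul' := fun c φ => DFunLike.coe_injective (by
        rw [RingHom.id_apply, RKHS.coe_smul, (c • φ).2.2.choose_spec, φ.2.2.choose_spec]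
        rw [← lieDerivative_smul V φ.2.1 c, ← RKHS.coe_smul]
        rfl) }

/-- The values of `lieOperator H V` are the Lie derivatives. -/
theorem coe_lieOperator_apply (H : Type*) [NormedAddCommGroup H] [InnerProductSpace ℂ H]
    [RKHS ℂ H M ℂ] (V : (m : M) → TangentSpace 𝓘(ℝ, E) m) (φ : (lieOperator H V).domain) :
    ((lieOperator H V φ : H) : M → ℂ) = lieDerivative V ((φ : H) : M → ℂ) :=
  φ.2.2.choose_spec

end Manifold

/-! ### Unbounded operators: essential self-adjointness and exponentials -/

section Operators

variable {H : Type*} [NormedAddCommGroup H] [InnerProductSpace ℂ H] [CompleteSpace H]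

/-- A densely defined symmetric operator whose closure is self-adjoint. -/
def IsEssentiallySelfAdjoint (T : H →ₗ.[ℂ] H) : Prop :=
  Dense (T.domain : Set H) ∧ T.IsFormalAdjoint T ∧ IsSelfAdjoint T.closure

variable (H) in
/-- A projection valued measure on the Borel sets of the real line: a strongly countably additive
and multiplicative map into the orthogonal projections, with value `1` on the whole line. -/
structure SpectralMeasure where
  /-- the projection attached to a Borel set -/
  proj : Set ℝ → H →L[ℂ] H
  not_measurable : ∀ B, ¬ MeasurableSet B → proj B = 0
  isStarProjection : ∀ B, MeasurableSet B → IsStarProjection (proj B)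
  univ : proj univ = 1
  inter : ∀ B C, MeasurableSet B → MeasurableSet C → proj (B ∩ C) = proj B * proj C
  iUnion : ∀ B : ℕ → Set ℝ, (∀ n, MeasurableSet (B n)) → Pairwise (Function.onFun Disjoint B) →
    ∀ x : H, HasSum (fun n => proj (B n) x) (proj (⋃ n, B n) x)

namespace SpectralMeasure

variable (P : SpectralMeasure H)

theorem norm_sq_eq (B : Set ℝ) (x : H) : ‖P.proj B x‖ ^ 2 = (⟪x, P.proj B x⟫_ℂ).re := by
  by_cases hB : MeasurableSet B
  · have h := P.isStarProjection B hB
    have h1 : P.proj B (P.proj B x) = P.proj B x := congrArg (fun T => T x) h.isIdempotentElem.eq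
    have h2 : ContinuousLinearMap.adjoint (P.proj B) = P.proj B := h.isSelfAdjoint
    rw [← inner_self_eq_norm_sq (𝕜 := ℂ)]
    conv_lhs => rw [← ContinuousLinearMap.adjoint_inner_right, h2, h1]
    rfl
  · simp [P.not_measurable B hB]

/-- The positive measure `B ↦ ⟪x, P(B) x⟫ = ‖P(B) x‖ ^ 2`. -/
def measure (x : H) : Measure ℝ :=
  Measure.ofMeasurable (fun B _ => ENNReal.ofReal (‖P.proj B x‖ ^ 2))
    (by
      have h := P.iUnion (fun _ => ∅) (fun _ => .empty) (fun _ _ _ => by simp [Function.onFun]) x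
      have h0 : P.proj ∅ x = 0 := tendsto_nhds_unique tendsto_const_nhds
        h.summable.tendsto_atTop_zero
      simp [h0])
    (by
      intro B hB hd
      have h := (P.iUnion B hB hd x).mapL (Complex.reCLM.comp ((innerSL ℂ x).restrictScalars ℝ))
      have h' : HasSum (fun n => ‖P.proj (B n) x‖ ^ 2) (‖P.proj (⋃ n, B n) x‖ ^ 2) := by
        simpa [P.norm_sq_eq] using h
      rw [← h'.tsum_eq, ENNReal.ofReal_tsum_of_nonneg (fun _ => by positivity) h'.summable])

/-- `P.IsIntegral f T` says that `T = ∫ f dP` for a real Borel function `f`: the domain of `T` is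
the set of all `x` for which `f` is square integrable with respect to `⟪x, P(·) x⟫`, and
`⟪x, T x⟫ = ∫ f(r) d⟪x, P(r) x⟫` there. By polarization, this determines `T`. -/
def IsIntegral (f : ℝ → ℝ) (T : H →ₗ.[ℂ] H) : Prop :=
  (∀ x : H, x ∈ T.domain ↔ MemLp f 2 (P.measure x)) ∧
    ∀ x : T.domain, ⟪(x : H), T x⟫_ℂ = ((∫ r, f r ∂(P.measure (x : H)) : ℝ) : ℂ)

end SpectralMeasure

/-- `IsExponential A t S` says that `S` is the (in general unbounded) operator `exp(tA)` of the
spectral calculus of the self-adjoint operator `A`: `A = ∫ r dP(r)` and `S = ∫ exp(tr) dP(r)`, where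
`P` is the spectral measure of `A`. -/
def IsExponential (A : H →ₗ.[ℂ] H) (t : ℝ) (S : H →ₗ.[ℂ] H) : Prop :=
  ∃ P : SpectralMeasure H, P.IsIntegral (fun r => r) A ∧ P.IsIntegral (fun r => Real.exp (t * r)) S

end Operators

end GeometricFroehlich

end

/-! The starting point is that `m ↦ K_m` is smooth as a map into `H`. Its Gram kernel `⟪K_x, K_y⟫ =
K x y` is smooth, and second mixed differences of a Gram kernel control the squared norm of `f x₁ -
f x₂ - D (x₁ - x₂)`; this gives strict differentiability (`exists_hasStrictFDerivAt_of_gram`). The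
Gram kernel of the derivative is the mixed derivative of the original one, so the argument repeats
(`contDiffOn_of_gram`). Since `φ m = ⟪K_m, φ⟫`, every `φ` is smooth, and its Lie derivative at `m`
is the pairing of `φ` with the derivative of the kernel vectors along `V` (`lieDerivative_coe`).

Let `T` be the restriction of the Lie derivative to the span of the `K_m`. Kernel symmetry makes `T`
symmetric, and the reproducing property identifies `T†` with the Lie derivative on its maximal
domain (`adjoint_domRestrict`). Essential self-adjointness and the description of the closure
therefore both follow once no nonzero vector is orthogonal to the range of `T + i` or of `T - i`
(`closure_eq_adjoint`).

This is where the flow enters. Along an integral curve `γ` the function `u t = K_{γ t}` satisfies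
`u' = T u`, and by symmetry `t ↦ ‖u (t / 2)‖ ^ 2` has nonnegative derivatives of all even orders.
Such a function obeys Cauchy estimates (`even_deriv_le`), so the derivatives of `u` at `0` grow like
`n! / ρ ^ n` (`isAnalyticChain_of_symmetric`). For such a sequence the series `e^{iyT}` converges
for small `y`, is isometric, and reproduces the hypotheses with the same constants, so it can be
iterated forever. The pairing with a deficiency vector is multiplied by `e^{ρ/4}` at each iteration
and yet stays bounded; hence it is zero (`IsAnalyticChain.inner_eq_zero`).

For the exponentials, the spectral theorem is derived from the bounded normal resolvent `(A + i)⁻¹`: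
its continuous functional calculus is extended to square integrable functions, and `A` becomes the
operator attached to a real function `κ` (`exists_eq_spectralOperator`). After spectral cutoff a
solution of `u' = A u` must be `e^{tA} u 0`; Fatou's lemma removes the cutoff
(`exp_apply_solution`), and `K_{γ t}` is such a solution. -/

noncomputable section

namespace GeometricFroehlich

/-! ### Differentiability of maps with a smooth Gram kernel -/

section Smoothness

open ContinuousLinearMap (inl inr)

variable {E : Type*} [NormedAddCommGroup E] [NormedSpace ℝ E]
  {F : Type*} [NormedAddCommGroup F] [NormedSpace ℝ F]
  {W : Type*} [NormedAddCommGroup W] [NormedSpace ℝ W]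

/-- The mixed second derivative of a function of two variables. -/
def mixedDeriv (K : E × E → W) (p : E × E) : E →L[ℝ] E →L[ℝ] W :=
  ((ContinuousLinearMap.compL ℝ E (E × E) W).flip (inl ℝ E E)).comp
    ((fderiv ℝ (fderiv ℝ K) p).comp (inr ℝ E E))

theorem mixedDeriv_apply (K : E × E → W) (p : E × E) (w v : E) :
    mixedDeriv K p w v = fderiv ℝ (fderiv ℝ K) p (0, w) (v, 0) := rfl

/-- Mean value inequality in `x` for `K (x, y₁) - K (x, y₂)` minus its linear model: the
`x`-derivative of this difference is small because `fderiv ℝ K` is strictly differentiable at `(x₀,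
x₀)`. The four points are independent, which later allows limits in one slot only. -/
theorem exists_mixed_difference_le {K : E × E → W} {x₀ : E}
    (hK : ContDiffAt ℝ 2 K (x₀, x₀)) {ε : ℝ} (hε : 0 < ε) :
    ∃ δ > 0, ∀ x₁ ∈ Metric.ball x₀ δ, ∀ x₂ ∈ Metric.ball x₀ δ, ∀ y₁ ∈ Metric.ball x₀ δ,
      ∀ y₂ ∈ Metric.ball x₀ δ,
      ‖K (x₁, y₁) - K (x₁, y₂) - (K (x₂, y₁) - K (x₂, y₂))
        - mixedDeriv K (x₀, x₀) (y₁ - y₂) (x₁ - x₂)‖ ≤ ε * ‖y₁ - y₂‖ * ‖x₁ - x₂‖ := by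
  have h1 : ContDiffAt ℝ 1 (fderiv ℝ K) (x₀, x₀) := hK.fderiv_right (by norm_num)
  have h2 := (h1.hasStrictFDerivAt one_ne_zero).isLittleO.def hε
  have h3 : ∀ᶠ p in 𝓝 (x₀, x₀), DifferentiableAt ℝ K p :=
    (hK.eventually (by simp)).mono fun p hp => hp.differentiableAt (by norm_num)
  rw [Metric.eventually_nhds_iff_ball] at h3
  obtain ⟨δ₁, hδ₁, h3⟩ := h3
  rw [nhds_prod_eq, ← nhds_prod_eq, Metric.eventually_nhds_iff_ball] at h2
  obtain ⟨δ₂, hδ₂, h2⟩ := h2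
  refine ⟨min δ₁ δ₂, lt_min hδ₁ hδ₂, fun x₁ hx₁ x₂ hx₂ y₁ hy₁ y₂ hy₂ => ?_⟩
  have hmem₁ : ∀ x ∈ Metric.ball x₀ (min δ₁ δ₂), ∀ y ∈ Metric.ball x₀ (min δ₁ δ₂),
      (x, y) ∈ Metric.ball (x₀, x₀) δ₁ := fun x hx y hy => by
    rw [← ball_prod_same]
    exact ⟨Metric.ball_subset_ball (min_le_left _ _) hx,
      Metric.ball_subset_ball (min_le_left _ _) hy⟩
  have hmem₂ : ∀ x ∈ Metric.ball x₀ (min δ₁ δ₂), ∀ y ∈ Metric.ball x₀ (min δ₁ δ₂),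
      (x, y) ∈ Metric.ball (x₀, x₀) δ₂ := fun x hx y hy => by
    rw [← ball_prod_same]
    exact ⟨Metric.ball_subset_ball (min_le_right _ _) hx,
      Metric.ball_subset_ball (min_le_right _ _) hy⟩
  have hd : ∀ y ∈ Metric.ball x₀ (min δ₁ δ₂), ∀ x ∈ Metric.ball x₀ (min δ₁ δ₂),
      HasFDerivAt (fun x => K (x, y)) ((fderiv ℝ K (x, y)).comp (inl ℝ E E)) x := by
    intro y hy x hx
    exact (h3 _ (hmem₁ x hx y hy)).hasFDerivAt.comp x (hasFDerivAt_prodMk_left x y)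
  have key := (convex_ball x₀ (min δ₁ δ₂)).norm_image_sub_le_of_norm_hasFDerivWithin_le
    (f := fun x => K (x, y₁) - K (x, y₂) - mixedDeriv K (x₀, x₀) (y₁ - y₂) x)
    (f' := fun x => (fderiv ℝ K (x, y₁)).comp (inl ℝ E E) - (fderiv ℝ K (x, y₂)).comp (inl ℝ E E)
      - mixedDeriv K (x₀, x₀) (y₁ - y₂)) (C := ε * ‖y₁ - y₂‖)
    (fun x hx => (((hd y₁ hy₁ x hx).sub (hd y₂ hy₂ x hx)).sub
      (ContinuousLinearMap.hasFDerivAt _)).hasFDerivWithinAt) (fun x hx => ?_) hx₂ hx₁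
  · convert key using 2
    simp only [map_sub]
    abel
  · have h4 := h2 ((x, y₁), (x, y₂)) (by
      rw [← ball_prod_same]
      exact ⟨hmem₂ x hx y₁ hy₁, hmem₂ x hx y₂ hy₂⟩)
    have h5 : (fderiv ℝ K (x, y₁)).comp (inl ℝ E E) - (fderiv ℝ K (x, y₂)).comp (inl ℝ E E)
        - mixedDeriv K (x₀, x₀) (y₁ - y₂) = (fderiv ℝ K (x, y₁) - fderiv ℝ K (x, y₂)
          - fderiv ℝ (fderiv ℝ K) (x₀, x₀) ((x, y₁) - (x, y₂))).comp (inl ℝ E E) := by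
      ext v
      have : ((0 : E), y₁ - y₂) = ((x, y₁) - (x, y₂) : E × E) := by simp
      simp only [mixedDeriv_apply, sub_apply, ContinuousLinearMap.comp_apply,
        ContinuousLinearMap.inl_apply, this]
    rw [h5]
    refine (ContinuousLinearMap.opNorm_comp_le _ _).trans ?_
    have h6 : ‖((x, y₁) - (x, y₂) : E × E)‖ = ‖y₁ - y₂‖ := by simp [Prod.norm_def]
    rw [← h6]
    exact (mul_le_mul h4 (ContinuousLinearMap.norm_inl_le_one ℝ E E) (norm_nonneg _)
      (by positivity)).trans (by simp)

/-- A bilinear form whose diagonal controls the square of the norm. -/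
def ControlsNorm (B : F →L[ℝ] F →L[ℝ] W) : Prop := ∀ f : F, ‖f‖ ^ 2 ≤ ‖B f f‖

theorem ControlsNorm.eq_zero {B : F →L[ℝ] F →L[ℝ] W} (hB : ControlsNorm B) {f : F}
    (h : B f f = 0) : f = 0 := by
  have := hB f
  rw [h, norm_zero] at this
  exact norm_eq_zero.1 (pow_eq_zero_iff two_ne_zero |>.1 (le_antisymm this (by positivity)))

variable (f : E → F) (x₀ : E)

/-- Difference quotients along the sequence `1 / (n + 1)`. -/
def diffQuotient (v : E) (n : ℕ) : F :=
  ((n : ℝ) + 1) • (f (x₀ + ((n : ℝ) + 1)⁻¹ • v) - f x₀)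

variable {f x₀}

/-- A map whose Gram kernel with respect to a norm controlling bilinear form is `C^2` is strictly
differentiable, and the mixed derivative of the kernel is the Gram kernel of the derivative. -/
theorem exists_hasStrictFDerivAt_of_gram [CompleteSpace F] {B : F →L[ℝ] F →L[ℝ] W} (hB : ControlsNorm B)
    (hK : ContDiffAt ℝ 2 (fun p : E × E => B (f p.1) (f p.2)) (x₀, x₀)) :
    ∃ D : E →L[ℝ] F, HasStrictFDerivAt f D x₀ := by
  set K := fun p : E × E => B (f p.1) (f p.2) with hKdef
  set G := mixedDeriv K (x₀, x₀) with hG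
  have est : ∀ ε > 0, ∃ δ > 0, ∀ x₁ ∈ Metric.ball x₀ δ, ∀ x₂ ∈ Metric.ball x₀ δ,
      ∀ y₁ ∈ Metric.ball x₀ δ, ∀ y₂ ∈ Metric.ball x₀ δ,
      ‖B (f x₁ - f x₂) (f y₁ - f y₂) - G (y₁ - y₂) (x₁ - x₂)‖ ≤ ε * ‖y₁ - y₂‖ * ‖x₁ - x₂‖ := by
    intro ε hε
    obtain ⟨δ, hδ, h⟩ := exists_mixed_difference_le hK hε
    refine ⟨δ, hδ, fun x₁ hx₁ x₂ hx₂ y₁ hy₁ y₂ hy₂ => ?_⟩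
    convert h x₁ hx₁ x₂ hx₂ y₁ hy₁ y₂ hy₂ using 3
    simp only [hKdef, map_sub, sub_apply]
    abel
  have hpt : ∀ v : E, Tendsto (fun n : ℕ => x₀ + ((n : ℝ) + 1)⁻¹ • v) atTop (𝓝 x₀) := by
    intro v
    have : Tendsto (fun n : ℕ => ((n : ℝ) + 1)⁻¹) atTop (𝓝 0) := by
      simpa using tendsto_one_div_add_atTop_nhds_zero_nat (𝕜 := ℝ)
    simpa using tendsto_const_nhds.add (this.smul_const v)
  -- Both indices tend to infinity independently; this joint limit is what yields the Cauchy
  -- property.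
  have hBq : ∀ v w : E, Tendsto (fun p : ℕ × ℕ => B (diffQuotient f x₀ v p.1)
      (diffQuotient f x₀ w p.2)) atTop (𝓝 (G w v)) := by
    intro v w
    rw [Metric.tendsto_nhds]
    intro ε hε
    obtain ⟨δ, hδ, h⟩ := est (ε / (‖w‖ * ‖v‖ + 1)) (by positivity)
    have hb : Metric.ball x₀ δ ∈ 𝓝 x₀ := Metric.ball_mem_nhds _ hδ
    have e1 := ((hpt v).eventually hb).prod_mk ((hpt w).eventually hb)
    rw [prod_atTop_atTop_eq] at e1
    filter_upwards [e1] with p hp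
    have h0 : x₀ ∈ Metric.ball x₀ δ := Metric.mem_ball_self hδ
    have h1 := h _ hp.1 x₀ h0 _ hp.2 x₀ h0
    have ha : (0 : ℝ) < (p.1 : ℝ) + 1 := by positivity
    have hb : (0 : ℝ) < (p.2 : ℝ) + 1 := by positivity
    simp only [add_sub_cancel_left, norm_smul, norm_inv, Real.norm_of_nonneg ha.le,
      Real.norm_of_nonneg hb.le, map_smul, smul_apply] at h1
    rw [dist_eq_norm]
    have h2 : B (diffQuotient f x₀ v p.1) (diffQuotient f x₀ w p.2) - G w v
        = (((p.1 : ℝ) + 1) * ((p.2 : ℝ) + 1)) •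
          (B (f (x₀ + ((p.1 : ℝ) + 1)⁻¹ • v) - f x₀) (f (x₀ + ((p.2 : ℝ) + 1)⁻¹ • w) - f x₀)
            - ((p.1 : ℝ) + 1)⁻¹ • ((p.2 : ℝ) + 1)⁻¹ • G w v) := by
      rw [smul_sub, smul_smul, smul_smul, diffQuotient, diffQuotient, map_smul, map_smul,
        smul_apply, smul_smul, mul_comm ((p.2 : ℝ) + 1)]
      rw [show ((p.1 : ℝ) + 1) * ((p.2 : ℝ) + 1) * ((p.1 : ℝ) + 1)⁻¹ * ((p.2 : ℝ) + 1)⁻¹ = 1 by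
          field_simp, one_smul]
    rw [h2, norm_smul, Real.norm_of_nonneg (by positivity)]
    calc _ ≤ (((p.1 : ℝ) + 1) * ((p.2 : ℝ) + 1)) * (ε / (‖w‖ * ‖v‖ + 1) *
        (((p.2 : ℝ) + 1)⁻¹ * ‖w‖) * (((p.1 : ℝ) + 1)⁻¹ * ‖v‖)) := by gcongr
      _ = ε * ((‖w‖ * ‖v‖) / (‖w‖ * ‖v‖ + 1)) := by field_simp
      _ < ε * 1 := by
        gcongr
        rw [div_lt_one (by positivity)]
        linarith
      _ = ε := mul_one _
  have hcauchy : ∀ v, CauchySeq (diffQuotient f x₀ v) := by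
    intro v
    have t1 := hBq v v
    have tsw : Tendsto (fun p : ℕ × ℕ => (p.2, p.1)) atTop atTop := by
      rw [← prod_atTop_atTop_eq]; exact tendsto_snd.prodMk tendsto_fst
    have td1 : Tendsto (fun p : ℕ × ℕ => (p.1, p.1)) atTop atTop := by
      rw [← prod_atTop_atTop_eq]; exact tendsto_fst.prodMk tendsto_fst
    have td2 : Tendsto (fun p : ℕ × ℕ => (p.2, p.2)) atTop atTop := by
      rw [← prod_atTop_atTop_eq]; exact tendsto_snd.prodMk tendsto_snd
    -- Expanding `B (q_n - q_m) (q_n - q_m)` gives four terms with the common limit `G v v`, so the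
    -- signs cancel. `B` is not assumed symmetric, hence the separate swapped term.
    have t := (((t1.comp td1).sub t1).sub (t1.comp tsw)).add (t1.comp td2)
    simp only [sub_self, zero_sub, neg_add_cancel] at t
    rw [cauchySeq_iff_tendsto_dist_atTop_0]
    have t2 : Tendsto (fun p : ℕ × ℕ => dist (diffQuotient f x₀ v p.1) (diffQuotient f x₀ v p.2) ^ 2)
        atTop (𝓝 0) := by
      refine squeeze_zero (fun _ => by positivity) (fun p => ?_) (tendsto_zero_iff_norm_tendsto_zero.1 t)
      rw [dist_eq_norm]
      refine (hB _).trans (le_of_eq ?_)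
      simp only [map_sub, sub_apply, Function.comp]
      congr 1
      abel
    have t3 := t2.sqrt
    simpa using t3
  choose D hD using fun v => cauchySeq_tendsto_of_complete (hcauchy v)
  have hB2 : Continuous fun p : F × F => B p.1 p.2 := by fun_prop
  have hBD : ∀ v w, B (D v) (D w) = G w v := by
    intro v w
    have := (hB2.tendsto (D v, D w)).comp (((hD v).comp tendsto_fst).prodMk_nhds
      ((hD w).comp tendsto_snd))
    rw [prod_atTop_atTop_eq] at this
    exact tendsto_nhds_unique this (hBq v w)
  -- Linearity is inherited from `G`: the form `B` vanishes on the diagonal at each linearity defect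
  -- of `D`, because `B (D v) (D w) = G w v` is bilinear.
  let Dl : E →ₗ[ℝ] F :=
    { toFun := D
      map_add' := fun v w => by
        rw [← sub_eq_zero]
        apply hB.eq_zero
        simp only [map_sub, map_add, sub_apply, add_apply,
          hBD]
        abel
      map_smul' := fun c v => by
        rw [← sub_eq_zero]
        apply hB.eq_zero
        simp only [map_sub, map_smul, sub_apply,
          smul_apply, hBD, RingHom.id_apply, sub_self, smul_zero] }
  let Dc : E →L[ℝ] F := Dl.mkContinuous (Real.sqrt ‖G‖) (fun v => by
    have h1 : ‖D v‖ ^ 2 ≤ ‖G‖ * ‖v‖ * ‖v‖ := by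
      refine (hB _).trans ?_
      rw [hBD]
      exact G.le_opNorm₂ v v
    refine le_of_sq_le_sq ?_ (by positivity)
    rw [mul_pow, Real.sq_sqrt (norm_nonneg G)]
    calc _ ≤ _ := h1
      _ = _ := by ring)
  have hDc : ∀ v, Dc v = D v := fun v => rfl
  refine ⟨Dc, ?_⟩
  refine .of_isLittleO (Asymptotics.IsLittleO.of_bound fun ε hε => ?_)
  -- The squared remainder splits below into three errors, each at most `ε ^ 2 / 3 * ‖w‖ ^ 2`.
  obtain ⟨δ, hδ, h⟩ := est (ε ^ 2 / 3) (by positivity)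
  have hball : Metric.ball x₀ δ ∈ 𝓝 x₀ := Metric.ball_mem_nhds _ hδ
  -- The four-point estimate with a difference quotient in one slot, passed to the limit there; `hr`
  -- does the same in the other slot.
  have hl : ∀ x₁ ∈ Metric.ball x₀ δ, ∀ x₂ ∈ Metric.ball x₀ δ, ∀ w,
      ‖B (f x₁ - f x₂) (D w) - G w (x₁ - x₂)‖ ≤ ε ^ 2 / 3 * ‖w‖ * ‖x₁ - x₂‖ := by
    intro x₁ hx₁ x₂ hx₂ w
    have ht : Tendsto (fun n => ‖B (f x₁ - f x₂) (diffQuotient f x₀ w n) - G w (x₁ - x₂)‖) atTop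
        (𝓝 ‖B (f x₁ - f x₂) (D w) - G w (x₁ - x₂)‖) :=
      ((((B (f x₁ - f x₂)).continuous.tendsto _).comp (hD w)).sub_const _).norm
    refine le_of_tendsto ht ?_
    filter_upwards [(hpt w).eventually hball] with n hn
    have h1 := h x₁ hx₁ x₂ hx₂ _ hn x₀ (Metric.mem_ball_self hδ)
    have ha : (0 : ℝ) < (n : ℝ) + 1 := by positivity
    rw [add_sub_cancel_left] at h1
    have h2 : B (f x₁ - f x₂) (diffQuotient f x₀ w n) - G w (x₁ - x₂) = ((n : ℝ) + 1) •
        (B (f x₁ - f x₂) (f (x₀ + ((n : ℝ) + 1)⁻¹ • w) - f x₀)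
          - G (((n : ℝ) + 1)⁻¹ • w) (x₁ - x₂)) := by
      rw [diffQuotient, map_smul, map_smul, smul_apply, smul_sub, smul_smul,
        mul_inv_cancel₀ ha.ne', one_smul]
    rw [h2, norm_smul, Real.norm_of_nonneg ha.le]
    rw [norm_smul, norm_inv, Real.norm_of_nonneg ha.le] at h1
    calc _ ≤ ((n : ℝ) + 1) * (ε ^ 2 / 3 * (((n : ℝ) + 1)⁻¹ * ‖w‖) * ‖x₁ - x₂‖) := by gcongr
      _ = _ := by field_simp
  have hr : ∀ x₁ ∈ Metric.ball x₀ δ, ∀ x₂ ∈ Metric.ball x₀ δ, ∀ w,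
      ‖B (D w) (f x₁ - f x₂) - G (x₁ - x₂) w‖ ≤ ε ^ 2 / 3 * ‖x₁ - x₂‖ * ‖w‖ := by
    intro x₁ hx₁ x₂ hx₂ w
    have ht : Tendsto (fun n => ‖B (diffQuotient f x₀ w n) (f x₁ - f x₂) - G (x₁ - x₂) w‖) atTop
        (𝓝 ‖B (D w) (f x₁ - f x₂) - G (x₁ - x₂) w‖) :=
      ((((B.flip (f x₁ - f x₂)).continuous.tendsto _).comp (hD w)).sub_const _).norm
    refine le_of_tendsto ht ?_
    filter_upwards [(hpt w).eventually hball] with n hn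
    have h1 := h _ hn x₀ (Metric.mem_ball_self hδ) x₁ hx₁ x₂ hx₂
    have ha : (0 : ℝ) < (n : ℝ) + 1 := by positivity
    rw [add_sub_cancel_left] at h1
    have h2 : B (diffQuotient f x₀ w n) (f x₁ - f x₂) - G (x₁ - x₂) w = ((n : ℝ) + 1) •
        (B (f (x₀ + ((n : ℝ) + 1)⁻¹ • w) - f x₀) (f x₁ - f x₂)
          - G (x₁ - x₂) (((n : ℝ) + 1)⁻¹ • w)) := by
      rw [diffQuotient, map_smul, map_smul, smul_apply, smul_sub, smul_smul,
        mul_inv_cancel₀ ha.ne', one_smul]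
    rw [h2, norm_smul, Real.norm_of_nonneg ha.le]
    rw [norm_smul, norm_inv, Real.norm_of_nonneg ha.le] at h1
    calc _ ≤ ((n : ℝ) + 1) * (ε ^ 2 / 3 * ‖x₁ - x₂‖ * (((n : ℝ) + 1)⁻¹ * ‖w‖)) := by gcongr
      _ = _ := by field_simp
  rw [nhds_prod_eq]
  filter_upwards [prod_mem_prod hball hball] with p hp
  set w := p.1 - p.2 with hw
  have e0 := h _ hp.1 _ hp.2 _ hp.1 _ hp.2
  have e1 := hl _ hp.1 _ hp.2 w
  have e2 := hr _ hp.1 _ hp.2 w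
  rw [← hw] at e0 e1 e2
  have e3 : ‖f p.1 - f p.2 - D w‖ ^ 2 ≤ (ε * ‖w‖) ^ 2 := by
    refine (hB _).trans ?_
    have : B (f p.1 - f p.2 - D w) (f p.1 - f p.2 - D w)
        = (B (f p.1 - f p.2) (f p.1 - f p.2) - G w w) - (B (f p.1 - f p.2) (D w) - G w w)
          - (B (D w) (f p.1 - f p.2) - G w w) := by
      rw [map_sub B, sub_apply, map_sub _ (f p.1 - f p.2), map_sub _ (f p.1 - f p.2), hBD]
      abel
    rw [this]
    refine (norm_sub_le _ _).trans ((add_le_add (norm_sub_le _ _) le_rfl).trans ?_)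
    calc _ ≤ ε ^ 2 / 3 * ‖w‖ * ‖w‖ + ε ^ 2 / 3 * ‖w‖ * ‖w‖ + ε ^ 2 / 3 * ‖w‖ * ‖w‖ := by gcongr
      _ = _ := by ring
  rw [hDc]
  exact le_of_sq_le_sq e3 (by positivity)

/-- The bilinear form on `E →L[ℝ] F` with values in bilinear forms on `E` induced by a bilinear form
on `F`. -/
def pairDerivs (E : Type*) [NormedAddCommGroup E] [NormedSpace ℝ E] (B : F →L[ℝ] F →L[ℝ] W) :
    (E →L[ℝ] F) →L[ℝ] (E →L[ℝ] F) →L[ℝ] E →L[ℝ] E →L[ℝ] W :=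
  (B.precompL E).precompR E

theorem pairDerivs_apply (B : F →L[ℝ] F →L[ℝ] W) (S T : E →L[ℝ] F) (w v : E) :
    pairDerivs E B S T w v = B (S v) (T w) := rfl

/-- Evaluation at `(v, v)` bounds `‖S v‖ ^ 2` by the norm of the induced form times `‖v‖ ^ 2`. The
space `E →L[ℝ] F` carries no Hilbert structure, but it does inherit this weaker property; this is
why the induction works with `ControlsNorm` and arbitrary values `W`. -/
theorem ControlsNorm.pairDerivs {B : F →L[ℝ] F →L[ℝ] W} (hB : ControlsNorm B) :
    ControlsNorm (F := E →L[ℝ] F) (W := E →L[ℝ] E →L[ℝ] W) (pairDerivs E B) := by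
  intro S
  have h1 : ‖S‖ ≤ Real.sqrt ‖GeometricFroehlich.pairDerivs E B S S‖ := by
    refine S.opNorm_le_bound (Real.sqrt_nonneg _) fun v => le_of_sq_le_sq ?_ (by positivity)
    rw [mul_pow, Real.sq_sqrt (norm_nonneg (GeometricFroehlich.pairDerivs E B S S))]
    refine (hB _).trans ?_
    rw [← pairDerivs_apply]
    refine (ContinuousLinearMap.le_opNorm₂ _ v v).trans (le_of_eq (by ring))
  calc ‖S‖ ^ 2 ≤ Real.sqrt ‖GeometricFroehlich.pairDerivs E B S S‖ ^ 2 := by gcongr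
    _ = _ := Real.sq_sqrt (norm_nonneg (GeometricFroehlich.pairDerivs E B S S))

/-- One slot is differentiated at a time, each step by uniqueness of derivatives of `B (f x) (f y)`.
-/
theorem mixedDeriv_gram {B : F →L[ℝ] F →L[ℝ] W} {U : Set E} (hU : IsOpen U)
    (hf : DifferentiableOn ℝ f U)
    (hK : ContDiffOn ℝ ∞ (fun p : E × E => B (f p.1) (f p.2)) (U ×ˢ U)) {p : E × E}
    (hp : p ∈ U ×ˢ U) :
    mixedDeriv (fun p : E × E => B (f p.1) (f p.2)) p
      = pairDerivs E B (fderiv ℝ f p.1) (fderiv ℝ f p.2) := by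
  have hd : ∀ x ∈ U, HasFDerivAt f (fderiv ℝ f x) x := fun x hx =>
    ((hf x hx).differentiableAt (hU.mem_nhds hx)).hasFDerivAt
  set K := fun p : E × E => B (f p.1) (f p.2) with hKdef
  obtain ⟨x, y⟩ := p
  have hx : x ∈ U := hp.1
  have hy : y ∈ U := hp.2
  have h1 : ∀ y ∈ U, ∀ v, fderiv ℝ K (x, y) (v, 0) = B (fderiv ℝ f x v) (f y) := by
    intro y hy v
    have hK1 : DifferentiableAt ℝ K (x, y) :=
      (hK.differentiableOn (by simp)).differentiableAt ((hU.prod hU).mem_nhds ⟨hx, hy⟩)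
    have e1 : HasFDerivAt (fun x => K (x, y)) ((fderiv ℝ K (x, y)).comp (inl ℝ E E)) x :=
      HasFDerivAt.comp (g := K) (f := fun x => (x, y)) x hK1.hasFDerivAt
        (hasFDerivAt_prodMk_left x y)
    have e2 : HasFDerivAt (fun x => K (x, y)) ((B.flip (f y)).comp (fderiv ℝ f x)) x :=
      (B.flip (f y)).hasFDerivAt.comp x (hd x hx)
    simpa using congrArg (fun T => T v) (e1.unique e2)
  ext w v
  rw [mixedDeriv_apply, pairDerivs_apply]
  have hK2 : DifferentiableAt ℝ (fderiv ℝ K) (x, y) :=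
    ((hK.fderiv_of_isOpen (m := 1) (hU.prod hU) (by norm_cast)).differentiableOn
      (by simp)).differentiableAt ((hU.prod hU).mem_nhds ⟨hx, hy⟩)
  have e1 : HasFDerivAt (fun y => fderiv ℝ K (x, y) (v, 0))
      (((ContinuousLinearMap.apply ℝ W ((v, 0) : E × E)).comp
        (fderiv ℝ (fderiv ℝ K) (x, y))).comp (inr ℝ E E)) y :=
    ((ContinuousLinearMap.apply ℝ W ((v, 0) : E × E)).hasFDerivAt.comp (x, y)
      hK2.hasFDerivAt).comp y (hasFDerivAt_prodMk_right x y)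
  have e2 : HasFDerivAt (fun y => B (fderiv ℝ f x v) (f y))
      ((B (fderiv ℝ f x v)).comp (fderiv ℝ f y)) y :=
    (B (fderiv ℝ f x v)).hasFDerivAt.comp y (hd y hy)
  have e3 : (fun y => fderiv ℝ K (x, y) (v, 0)) =ᶠ[𝓝 y] fun y => B (fderiv ℝ f x v) (f y) :=
    Filter.eventually_of_mem (hU.mem_nhds hy) fun y hy => h1 y hy v
  simpa using congrArg (fun T => T w) (e1.unique (e2.congr_of_eventuallyEq e3))

theorem differentiableOn_of_gram [CompleteSpace F] {B : F →L[ℝ] F →L[ℝ] W} (hB : ControlsNorm B) {U : Set E}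
    (hU : IsOpen U)
    (hK : ContDiffOn ℝ ∞ (fun p : E × E => B (f p.1) (f p.2)) (U ×ˢ U)) :
    DifferentiableOn ℝ f U := fun x hx => by
  obtain ⟨D, hD⟩ := exists_hasStrictFDerivAt_of_gram hB
    ((hK.contDiffAt ((hU.prod hU).mem_nhds (Set.mk_mem_prod hx hx))).of_le (by norm_cast))
  exact hD.hasFDerivAt.differentiableAt.differentiableWithinAt

theorem contDiffOn_gram_fderiv [CompleteSpace F] {B : F →L[ℝ] F →L[ℝ] W} (hB : ControlsNorm B) {U : Set E}
    (hU : IsOpen U)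
    (hK : ContDiffOn ℝ ∞ (fun p : E × E => B (f p.1) (f p.2)) (U ×ˢ U)) :
    ContDiffOn ℝ ∞ (fun p : E × E => pairDerivs E B (fderiv ℝ f p.1) (fderiv ℝ f p.2))
      (U ×ˢ U) := by
  have h1 : ContDiffOn ℝ ∞ (fderiv ℝ fun p : E × E => B (f p.1) (f p.2)) (U ×ˢ U) :=
    hK.fderiv_of_isOpen (hU.prod hU) (by simp)
  have h2 := h1.fderiv_of_isOpen (m := ∞) (hU.prod hU) (by simp)
  have h3 : ContDiffOn ℝ ∞ (mixedDeriv fun p : E × E => B (f p.1) (f p.2)) (U ×ˢ U) :=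
    contDiffOn_const.clm_comp (h2.clm_comp contDiffOn_const)
  exact h3.congr fun p hp => (mixedDeriv_gram hU (differentiableOn_of_gram hB hU hK) hK hp).symm

end Smoothness

/-! ### Bootstrapping to smoothness of all orders -/

section Bootstrap

universe u v w

/-- The target changes from `F` to `E →L[ℝ] F` in the induction step, so `F` and `W` are quantified
inside, in universes containing that of `E` and hence stable under this passage. -/
theorem contDiffOn_nat_of_gram {E : Type u} [NormedAddCommGroup E] [NormedSpace ℝ E] {U : Set E}
    (hU : IsOpen U) (n : ℕ) : ∀ {F : Type (max u v)} [NormedAddCommGroup F] [NormedSpace ℝ F]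
    [CompleteSpace F] {W : Type (max u w)} [NormedAddCommGroup W] [NormedSpace ℝ W]
    {B : F →L[ℝ] F →L[ℝ] W} (_ : ControlsNorm B) {f : E → F}
    (_ : ContDiffOn ℝ ∞ (fun p : E × E => B (f p.1) (f p.2)) (U ×ˢ U)),
    ContDiffOn ℝ n f U := by
  induction n with
  | zero =>
    intro F _ _ _ W _ _ B hB f hK
    exact contDiffOn_zero.2 (differentiableOn_of_gram hB hU hK).continuousOn
  | succ n ih =>
    intro F _ _ _ W _ _ B hB f hK
    push_cast
    rw [contDiffOn_succ_iff_fderiv_of_isOpen hU]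
    exact ⟨differentiableOn_of_gram hB hU hK, by simp,
      ih hB.pairDerivs (contDiffOn_gram_fderiv hB hU hK)⟩

/-- A map into a Banach space whose Gram kernel with respect to a norm controlling bilinear form is
smooth is itself smooth. -/
theorem contDiffOn_of_gram {E : Type u} [NormedAddCommGroup E] [NormedSpace ℝ E] {U : Set E}
    (hU : IsOpen U) {F : Type v} [NormedAddCommGroup F] [NormedSpace ℝ F]
    [CompleteSpace F] {W : Type w} [NormedAddCommGroup W] [NormedSpace ℝ W]
    {B : F →L[ℝ] F →L[ℝ] W} (hB : ControlsNorm B) {f : E → F}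
    (hK : ContDiffOn ℝ ∞ (fun p : E × E => B (f p.1) (f p.2)) (U ×ˢ U)) :
    ContDiffOn ℝ ∞ f U := by
  rw [contDiffOn_infty_iff_fderiv_of_isOpen hU]
  -- Splitting off one derivative moves the target into universe `max u v`, where the induction
  -- applies.
  refine ⟨differentiableOn_of_gram hB hU hK, contDiffOn_infty.2 fun n => ?_⟩
  exact contDiffOn_nat_of_gram.{u, max u v, max u w} hU n hB.pairDerivs
    (contDiffOn_gram_fderiv hB hU hK)

end Bootstrap

/-! ### Derivatives along vector fields and the passage to manifolds -/

section FieldDerivative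

variable {E : Type*} [NormedAddCommGroup E] [NormedSpace ℝ E]
  {M : Type*} [TopologicalSpace M] [ChartedSpace E M]
  {F : Type*} [NormedAddCommGroup F] [NormedSpace ℝ F]

/-- The derivative of a vector valued function along a vector field. -/
def fieldDerivative (V : (m : M) → TangentSpace 𝓘(ℝ, E) m) (g : M → F) (m : M) : F :=
  mfderiv 𝓘(ℝ, E) 𝓘(ℝ, F) g m (V m)

/-- The derivative along `V` is the fibre component of the tangent map of `g` composed with the
section `V`. Smoothness is kept, so it can be iterated. -/
theorem contMDiff_fieldDerivative [IsManifold 𝓘(ℝ, E) ∞ M]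
    {V : (m : M) → TangentSpace 𝓘(ℝ, E) m}
    (hV : ContMDiff 𝓘(ℝ, E) 𝓘(ℝ, E).tangent ∞ (fun m => (⟨m, V m⟩ : TangentBundle 𝓘(ℝ, E) M)))
    {g : M → F} (hg : ContMDiff 𝓘(ℝ, E) 𝓘(ℝ, F) ∞ g) :
    ContMDiff 𝓘(ℝ, E) 𝓘(ℝ, F) ∞ (fieldDerivative V g) :=
  ((contMDiff_snd_tangentBundle_modelSpace F 𝓘(ℝ, F)).of_le le_top).comp
    ((hg.contMDiff_tangentMap (by simp)).comp hV)

theorem hasDerivAt_comp_integralCurve {V : (m : M) → TangentSpace 𝓘(ℝ, E) m} {g : M → F}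
    (hg : ContMDiff 𝓘(ℝ, E) 𝓘(ℝ, F) ∞ g) {γ : ℝ → M} {a b t : ℝ} (ht : t ∈ Ioo a b)
    (hγ : IsMIntegralCurveOn γ V (Ioo a b)) :
    HasDerivAt (fun t => g (γ t)) (fieldDerivative V g (γ t)) t := by
  have h1 := (hγ t ht).hasMFDerivAt (Ioo_mem_nhds ht.1 ht.2)
  have h2 := (hg.mdifferentiable (by simp) (γ t)).hasMFDerivAt
  let L : ℝ →L[ℝ] F := mfderiv 𝓘(ℝ, E) 𝓘(ℝ, F) g (γ t) ∘SL (1 : ℝ →L[ℝ] ℝ).smulRight (V (γ t))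
  have h3 : HasFDerivAt (fun t => g (γ t)) L t := (h2.comp t h1).hasFDerivAt
  have h4 : L 1 = fieldDerivative V g (γ t) := by
    change mfderiv 𝓘(ℝ, E) 𝓘(ℝ, F) g (γ t) ((1 : ℝ) • V (γ t)) = _
    rw [one_smul]
    rfl
  exact h4 ▸ h3.hasDerivAt

theorem lieDerivative_clm_comp (V : (m : M) → TangentSpace 𝓘(ℝ, E) m) {g : M → F}
    (hg : ContMDiff 𝓘(ℝ, E) 𝓘(ℝ, F) ∞ g) (ℓ : F →L[ℝ] ℂ) (m : M) :
    lieDerivative V (fun x => ℓ (g x)) m = ℓ (fieldDerivative V g m) := by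
  have h1 := (hg.mdifferentiable (by simp) m).hasMFDerivAt
  have h2 := (ℓ.hasMFDerivAt (x := g m)).comp m h1
  have h3 : mfderiv 𝓘(ℝ, E) 𝓘(ℝ, ℂ) (fun x => ℓ (g x)) m = _ := h2.mfderiv
  rw [lieDerivative, h3]
  rfl

/-- A map from a manifold to a Banach space whose Gram kernel with respect to a norm controlling
bilinear form is smooth is itself smooth. -/
theorem contMDiff_of_gram [IsManifold 𝓘(ℝ, E) ∞ M] [CompleteSpace F]
    {W : Type*} [NormedAddCommGroup W] [NormedSpace ℝ W]
    {B : F →L[ℝ] F →L[ℝ] W} (hB : ControlsNorm B) {k : M → F}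
    (hK : ContMDiff (𝓘(ℝ, E).prod 𝓘(ℝ, E)) 𝓘(ℝ, W) ∞ (fun p : M × M => B (k p.1) (k p.2))) :
    ContMDiff 𝓘(ℝ, E) 𝓘(ℝ, F) ∞ k := by
  intro m
  set e := chartAt E m with he
  have hs : ContMDiffOn 𝓘(ℝ, E) 𝓘(ℝ, E) ∞ e.symm e.target := contMDiffOn_chart_symm
  have h1 : ContDiffOn ℝ ∞ (fun p : E × E => B (k (e.symm p.1)) (k (e.symm p.2)))
      (e.target ×ˢ e.target) := by
    rw [← contMDiffOn_iff_contDiffOn]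
    exact hK.comp_contMDiffOn ((hs.comp contDiff_fst.contMDiff.contMDiffOn fun p hp => hp.1).prodMk
      (hs.comp contDiff_snd.contMDiff.contMDiffOn fun p hp => hp.2))
  have h2 := (contDiffOn_of_gram e.open_target hB (f := fun x => k (e.symm x)) h1).contMDiffOn
  have h3 : ContMDiffOn 𝓘(ℝ, E) 𝓘(ℝ, F) ∞ k e.source :=
    (h2.comp contMDiffOn_chart fun x hx => e.map_source hx).congr fun x hx =>
      congrArg k (e.left_inv hx).symm
  exact h3.contMDiffAt (e.open_source.mem_nhds (mem_chart_source E m))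

end FieldDerivative

/-! ### Kernel vectors in the reproducing kernel Hilbert space -/

section Kernel

variable {M : Type*} {H : Type*} [NormedAddCommGroup H] [InnerProductSpace ℂ H] [CompleteSpace H]
    [RKHS ℂ H M ℂ]

@[simp]
theorem kernelVector_inner (m : M) (φ : H) : ⟪kernelVector H m, φ⟫_ℂ = φ m := by
  rw [kernelVector, RKHS.kerFun_inner]
  simp

theorem kernelSpan_dense : Dense (kernelSpan (M := M) H : Set H) := by
  rw [Submodule.dense_iff_topologicalClosure_eq_top, Submodule.topologicalClosure_eq_top_iff,
    Submodule.eq_bot_iff]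
  intro φ hφ
  refine DFunLike.ext _ _ fun m => ?_
  rw [RKHS.coe_zero, Pi.zero_apply, ← kernelVector_inner]
  exact hφ _ (Submodule.subset_span ⟨m, rfl⟩)

theorem HasKernel.inner_eq {K : M → M → ℂ} (hH : HasKernel H K) (x y : M) :
    ⟪kernelVector H x, kernelVector H y⟫_ℂ = K x y := by
  rw [kernelVector_inner, hH y x]

/-- The real linear functional `h ↦ ⟪h, φ⟫`. -/
def innerLeftCLM (φ : H) : H →L[ℝ] ℂ :=
  (Complex.conjCLE : ℂ →L[ℝ] ℂ).comp ((innerSL ℂ φ).restrictScalars ℝ)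

omit [CompleteSpace H] [RKHS ℂ H M ℂ] in
@[simp]
theorem innerLeftCLM_apply (φ h : H) : innerLeftCLM φ h = ⟪h, φ⟫_ℂ := by
  simp [innerLeftCLM]

variable {E : Type*} [NormedAddCommGroup E] [NormedSpace ℝ E]
  [TopologicalSpace M] [ChartedSpace E M]

/-- The real inner product on `H` controls the norm, and its Gram kernel on the kernel vectors is
the real part of `K`. -/
theorem contMDiff_kernelVector [IsManifold 𝓘(ℝ, E) ∞ M] {K : M → M → ℂ}
    (hK : ContMDiff (𝓘(ℝ, E).prod 𝓘(ℝ, E)) 𝓘(ℝ, ℂ) ∞ (fun p : M × M => K p.1 p.2))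
    (hH : HasKernel H K) : ContMDiff 𝓘(ℝ, E) 𝓘(ℝ, H) ∞ (kernelVector (M := M) H) := by
  let _ : InnerProductSpace ℝ H := InnerProductSpace.complexToReal
  refine contMDiff_of_gram (B := innerSL ℝ (E := H)) (fun f => ?_) ?_
  · rw [innerSL_apply_apply, real_inner_self_eq_norm_sq]
    exact le_abs_self _
  · refine ((Complex.reCLM.contDiff.contMDiff).comp hK).congr fun p => ?_
    change ⟪kernelVector H p.1, kernelVector H p.2⟫_ℝ = _
    rw [Function.comp_apply, ← hH.inner_eq]
    rfl

theorem contMDiff_coe_of_contMDiff_kernelVector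
    (hk : ContMDiff 𝓘(ℝ, E) 𝓘(ℝ, H) ∞ (kernelVector (M := M) H)) (φ : H) :
    IsSmooth (E := E) (φ : M → ℂ) :=
  ((innerLeftCLM φ).contDiff.contMDiff.comp hk).congr fun m => by simp

/-- Evaluation is `x ↦ ⟪K_x, φ⟫`, which is real linear and continuous in `K_x`; the derivative falls
on the kernel vector. -/
theorem lieDerivative_coe (V : (m : M) → TangentSpace 𝓘(ℝ, E) m)
    (hk : ContMDiff 𝓘(ℝ, E) 𝓘(ℝ, H) ∞ (kernelVector (M := M) H)) (φ : H) (m : M) :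
    lieDerivative V (φ : M → ℂ) m = ⟪fieldDerivative V (kernelVector (M := M) H) m, φ⟫_ℂ := by
  rw [← innerLeftCLM_apply, ← lieDerivative_clm_comp V hk]
  congr 1
  ext x
  simp

end Kernel

/-! ### Cauchy estimates from positivity of even derivatives -/

section AbsolutelyMonotone

theorem nonneg_of_hasDerivAt_nonneg {f f' : ℝ → ℝ} {r : ℝ}
    (hf : ∀ x ∈ Icc 0 r, HasDerivAt f (f' x) x) (h0 : 0 ≤ f 0) (hf' : ∀ x ∈ Icc 0 r, 0 ≤ f' x) :
    ∀ x ∈ Icc 0 r, 0 ≤ f x := by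
  have hm : MonotoneOn f (Icc 0 r) := monotoneOn_of_hasDerivWithinAt_nonneg (convex_Icc 0 r)
    (fun x hx => (hf x hx).continuousAt.continuousWithinAt)
    (fun x hx => (hf x (interior_subset hx)).hasDerivWithinAt)
    (fun x hx => hf' x (interior_subset hx))
  intro x hx
  exact h0.trans (hm ⟨le_rfl, hx.1.trans hx.2⟩ hx hx.1)

/-- The Taylor coefficients of an absolutely monotone function. -/
theorem taylor_coeff_le_of_absolutelyMonotone {r : ℝ} (k : ℕ) : ∀ {G : ℕ → ℝ → ℝ}
    (_ : ∀ j, ∀ x ∈ Icc 0 r, HasDerivAt (G j) (G (j + 1) x) x)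
    (_ : ∀ j, ∀ x ∈ Icc 0 r, 0 ≤ G j x),
    ∀ x ∈ Icc 0 r, G k 0 * (x ^ k / k.factorial) ≤ G 0 x := by
  induction k with
  | zero =>
    intro G hG h0 x hx
    have := nonneg_of_hasDerivAt_nonneg (f := fun x => G 0 x - G 0 0)
      (fun x hx => (hG 0 x hx).sub_const _) (by simp) (h0 1) x hx
    simpa using this
  | succ k ih =>
    intro G hG h0 x hx
    have hd : ∀ x ∈ Icc 0 r, HasDerivAt
        (fun x => G 0 x - G (k + 1) 0 * (x ^ (k + 1) / (k + 1).factorial))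
        (G 1 x - G (k + 1) 0 * (x ^ k / k.factorial)) x := by
      intro x hx
      have h1 := (((hasDerivAt_pow (k + 1) x).div_const ((k + 1).factorial : ℝ)).const_mul
        (G (k + 1) 0))
      refine ((hG 0 x hx).sub h1).congr_deriv ?_
      rw [Nat.factorial_succ]
      have : (k.factorial : ℝ) ≠ 0 := by positivity
      push_cast
      field_simp
    have := nonneg_of_hasDerivAt_nonneg hd
      (by simpa using h0 0 0 ⟨le_rfl, hx.1.trans hx.2⟩)
      (fun x hx => sub_nonneg.2 (ih (G := fun j => G (j + 1)) (fun j => hG (j + 1))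
        (fun j => h0 (j + 1)) x hx)) x hx
    exact sub_nonneg.1 this

/-- If all derivatives of even order of a function are nonnegative on `[-r, r]`, then those at `0`
satisfy Cauchy type estimates. -/
theorem even_deriv_le {S : ℕ → ℝ → ℝ} {r : ℝ} (hr : 0 ≤ r)
    (hS : ∀ j, ∀ x ∈ Icc (-r) r, HasDerivAt (S j) (S (j + 1) x) x)
    (h0 : ∀ j, ∀ x ∈ Icc (-r) r, 0 ≤ S (2 * j) x) (n : ℕ) :
    2 * S (2 * n) 0 * (r ^ (2 * n) / (2 * n).factorial) ≤ S 0 r + S 0 (-r) := by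
  -- `G j` is the `j`-th derivative of the even function `S 0 x + S 0 (-x)`. Its odd derivatives
  -- vanish at `0` and have nonnegative derivative, so all `G j` are nonnegative on `[0, r]`.
  set G : ℕ → ℝ → ℝ := fun j x => S j x + (-1) ^ j * S j (-x) with hGdef
  have hG : ∀ j, ∀ x ∈ Icc 0 r, HasDerivAt (G j) (G (j + 1) x) x := by
    intro j x hx
    have h1 := hS j x ⟨by linarith [hx.1], hx.2⟩
    have h2 : HasDerivAt (fun x => S j (-x)) (S (j + 1) (-x) * -1) x :=
      (hS j (-x) ⟨by linarith [hx.2], by linarith [hx.1, hx.2]⟩).comp x (hasDerivAt_neg x)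
    refine (h1.add (h2.const_mul ((-1 : ℝ) ^ j))).congr_deriv ?_
    simp only [hGdef]
    ring
  have heven : ∀ j, ∀ x ∈ Icc 0 r, 0 ≤ G (2 * j) x := by
    intro j x hx
    have h1 := h0 j x ⟨by linarith [hx.1], hx.2⟩
    have h2 := h0 j (-x) ⟨by linarith [hx.2], by linarith [hx.1, hx.2]⟩
    simp only [hGdef, pow_mul, neg_one_sq, one_pow, one_mul]
    exact add_nonneg h1 h2
  have hodd : ∀ j, ∀ x ∈ Icc 0 r, 0 ≤ G (2 * j + 1) x := fun j =>
    nonneg_of_hasDerivAt_nonneg (hG (2 * j + 1))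
      (by simp [hGdef, pow_add, pow_mul]) (heven (j + 1))
  have hall : ∀ j, ∀ x ∈ Icc 0 r, 0 ≤ G j x := by
    intro j
    obtain ⟨i, rfl | rfl⟩ := Nat.even_or_odd' j
    · exact heven i
    · exact hodd i
  have := taylor_coeff_le_of_absolutelyMonotone (2 * n) hG hall r ⟨hr, le_rfl⟩
  simpa [hGdef, pow_mul, ← two_mul] using this

end AbsolutelyMonotone

/-! ### Analytic vectors and the unitary rotation `e^{iyT}` -/

section Chains

variable {H : Type*} [NormedAddCommGroup H] [InnerProductSpace ℂ H]

/-- A sequence of vectors whose Gram matrix is a Hankel matrix and whose norms grow like those of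
the iterates of an operator at an analytic vector. -/
structure IsAnalyticChain (C ρ : ℝ) (x : ℕ → H) : Prop where
  hankel : ∀ m n, ⟪x (m + 1), x n⟫_ℂ = ⟪x m, x (n + 1)⟫_ℂ
  norm_le : ∀ n, ‖x n‖ ≤ C * n.factorial / ρ ^ n

/-- From `(n + k)! ≤ 2 ^ (n + k) * n! * k!` the exponential series is dominated by a geometric one
of ratio `2 * r / ρ`. With `r = 3 / 8 * ρ`, as used below, this ratio is `3 / 4`. -/
theorem exp_term_bound {C ρ r : ℝ} (hρ : 0 < ρ) {x : ℕ → H} (hx : IsAnalyticChain C ρ x)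
    {y : ℝ} (hy : |y| ≤ r) (n k : ℕ) :
    ‖((Complex.I * y) ^ k / k.factorial : ℂ) • x (n + k)‖ ≤
      C * n.factorial * (2 / ρ) ^ n * (2 * r / ρ) ^ k := by
  have hr : 0 ≤ r := (abs_nonneg y).trans hy
  have hC : 0 ≤ C := by simpa using (norm_nonneg _).trans (hx.norm_le 0)
  have h1 : ((n + k).factorial : ℝ) ≤ 2 ^ (n + k) * n.factorial * k.factorial := by
    have h2 := Nat.add_choose_mul_factorial_mul_factorial n k
    have h3 := Nat.choose_le_two_pow (n + k) k
    rw [← h2]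
    push_cast
    gcongr
    exact_mod_cast h3
  have hk : (0 : ℝ) < k.factorial := by positivity
  rw [norm_smul, norm_div, norm_pow, norm_mul, Complex.norm_I, one_mul, Complex.norm_real,
    Complex.norm_natCast, Real.norm_eq_abs]
  calc _ ≤ r ^ k / k.factorial * (C * (2 ^ (n + k) * n.factorial * k.factorial) / ρ ^ (n + k)) := by
        gcongr
        refine (hx.norm_le _).trans ?_
        gcongr
    _ = _ := by
        rw [pow_add, pow_add, div_pow, div_pow, mul_pow]
        field_simp

/-- The sequence `∑ k, (iy)^k / k! • x (n + k)`. -/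
def rotateChain (x : ℕ → H) (y : ℝ) (n : ℕ) : H :=
  ∑' k : ℕ, ((Complex.I * y) ^ k / k.factorial : ℂ) • x (n + k)

variable [CompleteSpace H] {C ρ : ℝ} {x : ℕ → H}

theorem summable_rotateChain (hρ : 0 < ρ) (hx : IsAnalyticChain C ρ x) {y : ℝ}
    (hy : |y| ≤ 3 / 8 * ρ) (n : ℕ) :
    Summable fun k : ℕ => ((Complex.I * y) ^ k / k.factorial : ℂ) • x (n + k) := by
  refine Summable.of_norm_bounded ?_ (exp_term_bound hρ hx hy n)
  refine (summable_geometric_of_lt_one (by positivity) ?_).mul_left _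
  rw [div_lt_one hρ]
  linarith

theorem hasDerivAt_rotateChain (hρ : 0 < ρ) (hx : IsAnalyticChain C ρ x) {y : ℝ}
    (hy : y ∈ Ioo (-(3 / 8 * ρ)) (3 / 8 * ρ)) (n : ℕ) :
    HasDerivAt (fun y => rotateChain x y n) (Complex.I • rotateChain x y (n + 1)) y := by
  set r := 3 / 8 * ρ with hr
  have hg : ∀ (k : ℕ) (y : ℝ), y ∈ Ioo (-r) r → HasDerivAt
      (fun y : ℝ => ((Complex.I * y) ^ k / k.factorial : ℂ) • x (n + k))
      ((k * (Complex.I * y) ^ (k - 1) * Complex.I / k.factorial : ℂ) • x (n + k)) y := by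
    intro k y _
    have h1 : HasDerivAt (fun y : ℝ => Complex.I * (y : ℂ)) Complex.I y := by
      simpa using (Complex.ofRealCLM.hasDerivAt (x := y)).const_mul Complex.I
    exact ((h1.pow k).div_const _).smul_const _
  have hsucc : ∀ (k : ℕ) (y : ℝ), (((k + 1 : ℕ) : ℂ) * (Complex.I * y) ^ (k + 1 - 1) * Complex.I /
      (k + 1).factorial : ℂ) • x (n + (k + 1)) =
      Complex.I • ((Complex.I * y) ^ k / k.factorial : ℂ) • x (n + 1 + k) := by
    intro k y
    rw [smul_smul, add_tsub_cancel_right, Nat.factorial_succ, show n + (k + 1) = n + 1 + k by ring]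
    congr 1
    have : (k.factorial : ℂ) ≠ 0 := by exact_mod_cast k.factorial_ne_zero
    have h2 : ((k : ℂ) + 1) ≠ 0 := by exact_mod_cast k.succ_ne_zero
    push_cast
    field_simp
  -- The term `k = 0` is constant in `y`; the derivative of the term `k + 1` is `I` times term `k`
  -- of the shifted series.
  let U : ℕ → ℝ := fun k => k.casesOn 0
    (fun k => C * (n + 1).factorial * (2 / ρ) ^ (n + 1) * (2 * r / ρ) ^ k)
  have hU : Summable U := by
    rw [← summable_nat_add_iff 1]
    refine (summable_geometric_of_lt_one (by positivity) ?_).mul_left _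
    rw [div_lt_one hρ]
    linarith
  have hbound : ∀ (k : ℕ) (y : ℝ), y ∈ Ioo (-r) r →
      ‖(k * (Complex.I * y) ^ (k - 1) * Complex.I / k.factorial : ℂ) • x (n + k)‖ ≤ U k := by
    intro k y hy
    cases k with
    | zero => simp [U]
    | succ k =>
      rw [hsucc, norm_smul, Complex.norm_I, one_mul]
      exact exp_term_bound hρ hx (abs_le.2 ⟨hy.1.le, hy.2.le⟩) (n + 1) k
  have hd := hasDerivAt_tsum_of_isPreconnected hU isOpen_Ioo isPreconnected_Ioo hg hbound hy
    (summable_rotateChain hρ hx (abs_le.2 ⟨hy.1.le, hy.2.le⟩) n) hy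
  refine hd.congr_deriv ?_
  rw [(Summable.of_norm_bounded hU fun k => hbound k y hy).tsum_eq_zero_add]
  simp_rw [hsucc]
  rw [(summable_rotateChain hρ hx (abs_le.2 ⟨hy.1.le, hy.2.le⟩) (n + 1)).tsum_const_smul]
  simp [rotateChain]

theorem inner_rotateChain (hρ : 0 < ρ) (hx : IsAnalyticChain C ρ x) {y : ℝ}
    (hy : |y| ≤ 3 / 8 * ρ) (w : H) (n : ℕ) :
    HasSum (fun k : ℕ => ((Complex.I * y) ^ k / k.factorial : ℂ) * ⟪w, x (n + k)⟫_ℂ)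
      ⟪w, rotateChain x y n⟫_ℂ := by
  have h := (summable_rotateChain hρ hx hy n).hasSum.mapL (innerSL ℂ w)
  simp only [innerSL_apply_apply, inner_smul_right] at h
  exact h

/-- The Hankel relation is transported termwise through the series, first in the right slot (`key`)
and then, after conjugation, in the left one. -/
theorem hankel_rotateChain (hρ : 0 < ρ) (hx : IsAnalyticChain C ρ x) {y : ℝ}
    (hy : |y| ≤ 3 / 8 * ρ) (m n : ℕ) :
    ⟪rotateChain x y (m + 1), rotateChain x y n⟫_ℂ
      = ⟪rotateChain x y m, rotateChain x y (n + 1)⟫_ℂ := by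
  have key : ∀ k, ⟪x (k + 1), rotateChain x y n⟫_ℂ = ⟪x k, rotateChain x y (n + 1)⟫_ℂ := by
    intro k
    refine (inner_rotateChain hρ hx hy _ n).unique ?_
    refine HasSum.congr_fun (inner_rotateChain hρ hx hy (x k) (n + 1)) fun l => ?_
    rw [hx.hankel, show n + l + 1 = n + 1 + l by ring]
  rw [← inner_conj_symm, ← inner_conj_symm (rotateChain x y m)]
  congr 1
  refine (inner_rotateChain hρ hx hy _ (m + 1)).unique ?_
  refine HasSum.congr_fun (inner_rotateChain hρ hx hy (rotateChain x y (n + 1)) m) fun l => ?_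
  rw [show m + 1 + l = m + l + 1 by ring, ← inner_conj_symm, key, inner_conj_symm]

/-- The derivative of the squared norm in `y` is `i` times the difference of the two sides of a
Hankel relation, hence zero. The bounds `C` and `ρ` therefore survive rotation without loss. -/
theorem norm_rotateChain (hρ : 0 < ρ) (hx : IsAnalyticChain C ρ x) {y : ℝ}
    (hy : y ∈ Ioo (-(3 / 8 * ρ)) (3 / 8 * ρ)) (n : ℕ) : ‖rotateChain x y n‖ = ‖x n‖ := by
  have hd : ∀ y ∈ Ioo (-(3 / 8 * ρ)) (3 / 8 * ρ),
      HasDerivAt (fun y => ⟪rotateChain x y n, rotateChain x y n⟫_ℂ) 0 y := by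
    intro y hy
    have h1 := hasDerivAt_rotateChain hρ hx hy n
    refine (h1.inner ℂ h1).congr_deriv ?_
    rw [inner_smul_left, inner_smul_right, Complex.conj_I,
      hankel_rotateChain hρ hx (abs_le.2 ⟨hy.1.le, hy.2.le⟩)]
    ring
  have h0 : (0 : ℝ) ∈ Ioo (-(3 / 8 * ρ)) (3 / 8 * ρ) := ⟨by linarith, by linarith⟩
  have hc := isOpen_Ioo.is_const_of_deriv_eq_zero isPreconnected_Ioo
    (fun y hy => (hd y hy).differentiableAt.differentiableWithinAt)
    (fun y hy => (hd y hy).deriv) hy h0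
  have hz : rotateChain x 0 n = x n := by
    rw [rotateChain, tsum_eq_single 0]
    · simp
    · intro k hk
      simp [hk]
  rw [hz] at hc
  simp only [inner_self_eq_norm_sq_to_K] at hc
  have h2 : ‖rotateChain x y n‖ ^ 2 = ‖x n‖ ^ 2 := by exact_mod_cast hc
  exact (pow_left_inj₀ (norm_nonneg _) (norm_nonneg _) two_ne_zero).1 h2

theorem IsAnalyticChain.rotate (hρ : 0 < ρ) (hx : IsAnalyticChain C ρ x) {y : ℝ}
    (hy : y ∈ Ioo (-(3 / 8 * ρ)) (3 / 8 * ρ)) : IsAnalyticChain C ρ (rotateChain x y) where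
  hankel := hankel_rotateChain hρ hx (abs_le.2 ⟨hy.1.le, hy.2.le⟩)
  norm_le n := (norm_rotateChain hρ hx hy n).trans_le (hx.norm_le n)

/-- An analytic chain is orthogonal to every vector that behaves like an eigenvector of the adjoint
with eigenvalue `i` or `-i`. -/
theorem IsAnalyticChain.inner_eq_zero (hρ : 0 < ρ) (hx : IsAnalyticChain C ρ x) {φ : H} {σ : ℝ}
    (hσ : σ ^ 2 = 1) (hφ : ∀ n, ⟪φ, x (n + 1)⟫_ℂ = -(Complex.I * σ) * ⟪φ, x n⟫_ℂ) :
    ⟪φ, x 0⟫_ℂ = 0 := by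
  have hσ' : |σ| = 1 := by rwa [← sq_eq_sq₀ (abs_nonneg _) zero_le_one, sq_abs, one_pow]
  -- With this sign `(iy)(-iσ) = ρ / 4`, so one rotation multiplies the pairing with `φ` by
  -- `e^{ρ/4}`; its size stays inside the admissible interval.
  set y := σ * (ρ / 4) with hy
  have hy1 : |y| < 3 / 8 * ρ := by
    rw [hy, abs_mul, hσ', one_mul, abs_of_pos (by positivity)]
    linarith
  have hy2 : y ∈ Ioo (-(3 / 8 * ρ)) (3 / 8 * ρ) := abs_lt.1 hy1
  have hiter : ∀ N : ℕ, ∃ z : ℕ → H, IsAnalyticChain C ρ z ∧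
      (∀ n, ⟪φ, z (n + 1)⟫_ℂ = -(Complex.I * σ) * ⟪φ, z n⟫_ℂ) ∧
      ⟪φ, z 0⟫_ℂ = Complex.exp (ρ / 4) ^ N * ⟪φ, x 0⟫_ℂ := by
    intro N
    induction N with
    | zero => exact ⟨x, hx, hφ, by simp⟩
    | succ N ih =>
      obtain ⟨z, hz, hz1, hz2⟩ := ih
      refine ⟨rotateChain z y, hz.rotate hρ hy2, fun n => ?_, ?_⟩
      · refine (inner_rotateChain hρ hz hy1.le φ (n + 1)).unique ?_
        refine HasSum.congr_fun
          ((inner_rotateChain hρ hz hy1.le φ n).mul_left (-(Complex.I * σ))) fun k => ?_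
        rw [show n + 1 + k = n + k + 1 by ring, hz1]
        ring
      · have hpow : ∀ k, ⟪φ, z k⟫_ℂ = (-(Complex.I * σ)) ^ k * ⟪φ, z 0⟫_ℂ := by
          intro k
          induction k with
          | zero => simp
          | succ k ihk => rw [hz1, ihk]; ring
        rw [pow_succ, mul_right_comm, ← hz2, mul_comm]
        refine (inner_rotateChain hρ hz hy1.le φ 0).unique ?_
        have he := (NormedSpace.expSeries_div_hasSum_exp ((ρ / 4 : ℝ) : ℂ)).mul_right ⟪φ, z 0⟫_ℂ
        rw [← Complex.exp_eq_exp_ℂ] at he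
        push_cast at he
        refine HasSum.congr_fun he fun k => ?_
        rw [zero_add, hpow, ← mul_assoc, div_mul_eq_mul_div, ← mul_pow]
        congr 3
        rw [hy]
        have h1 : (σ : ℂ) ^ 2 = 1 := by exact_mod_cast hσ
        push_cast
        linear_combination (ρ / 4 : ℂ) * h1 - (σ : ℂ) ^ 2 * (ρ / 4) * (Complex.I_sq)
  by_contra hne
  -- Every rotated chain still starts with a vector of norm at most `C`, so a nonzero pairing could
  -- not grow geometrically.
  have hb : ∀ N : ℕ, Real.exp (ρ / 4) ^ N ≤ ‖φ‖ * C / ‖⟪φ, x 0⟫_ℂ‖ := by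
    intro N
    obtain ⟨z, hz, -, hz2⟩ := hiter N
    rw [le_div_iff₀ (norm_pos_iff.2 hne)]
    have h1 : ‖⟪φ, z 0⟫_ℂ‖ = Real.exp (ρ / 4) ^ N * ‖⟪φ, x 0⟫_ℂ‖ := by
      rw [hz2, norm_mul, norm_pow, show ((ρ : ℂ) / 4) = ((ρ / 4 : ℝ) : ℂ) by push_cast; rfl,
        Complex.norm_exp_ofReal]
    rw [← h1]
    refine (norm_inner_le_norm _ _).trans ?_
    gcongr
    simpa using hz.norm_le 0
  obtain ⟨N, hN⟩ := pow_unbounded_of_one_lt (‖φ‖ * C / ‖⟪φ, x 0⟫_ℂ‖)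
    (Real.one_lt_exp_iff.2 (by positivity : 0 < ρ / 4))
  exact absurd (hb N) (not_le.2 hN)

end Chains

/-! ### Symmetric flows produce analytic vectors -/

section SymmetricFlow

variable {H : Type*} [NormedAddCommGroup H] [InnerProductSpace ℂ H] {u : ℕ → ℝ → H} {ε : ℝ}

/-- The symmetry relation has two independent times, so it may be differentiated in `t` alone to
raise `n` and in `s` alone to raise `m`. The diagonal `s = t` would not suffice for this. -/
theorem hankel_of_symmetric (hu : ∀ n, ∀ t ∈ Ioo (-ε) ε, HasDerivAt (u n) (u (n + 1) t) t)
    (hsym : ∀ s ∈ Ioo (-ε) ε, ∀ t ∈ Ioo (-ε) ε, ⟪u 1 s, u 0 t⟫_ℂ = ⟪u 0 s, u 1 t⟫_ℂ) (m n : ℕ) :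
    ∀ s ∈ Ioo (-ε) ε, ∀ t ∈ Ioo (-ε) ε, ⟪u (m + 1) s, u n t⟫_ℂ = ⟪u m s, u (n + 1) t⟫_ℂ := by
  have hdiff : ∀ {f g : ℝ → ℂ} {f' g' : ℂ} {t : ℝ}, t ∈ Ioo (-ε) ε →
      (∀ t ∈ Ioo (-ε) ε, f t = g t) → HasDerivAt f f' t → HasDerivAt g g' t → f' = g' := by
    intro f g f' g' t ht h hf hg
    exact hf.unique (hg.congr_of_eventuallyEq
      (Filter.eventually_of_mem (isOpen_Ioo.mem_nhds ht) h))
  have hr : ∀ (m n : ℕ) (s : ℝ), ∀ t ∈ Ioo (-ε) ε,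
      HasDerivAt (fun t => ⟪u m s, u n t⟫_ℂ) ⟪u m s, u (n + 1) t⟫_ℂ t := by
    intro m n s t ht
    simpa using (hasDerivAt_const t (u m s)).inner ℂ (hu n t ht)
  have hl : ∀ (m n : ℕ) (t : ℝ), ∀ s ∈ Ioo (-ε) ε,
      HasDerivAt (fun s => ⟪u m s, u n t⟫_ℂ) ⟪u (m + 1) s, u n t⟫_ℂ s := by
    intro m n t s hs
    simpa using (hu m s hs).inner ℂ (hasDerivAt_const s (u n t))
  induction m with
  | zero =>
    induction n with
    | zero => exact hsym
    | succ n ih => exact fun s hs t ht => hdiff ht (ih s hs) (hr 1 n s t ht) (hr 0 (n + 1) s t ht)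
  | succ m ih =>
    exact fun s hs t ht => hdiff hs (fun s hs => ih s hs t ht) (hl (m + 1) n t s hs)
      (hl m (n + 1) t s hs)

/-- Apply `even_deriv_le` to `x ↦ ‖u 0 (x / 2)‖ ^ 2`. By the Hankel relation its `j`-th derivative
is `Re ⟪u j, u 0⟫` at `x / 2`: the two halves from the product rule add up to `1`. For even order `2
* j` this is `‖u j (x / 2)‖ ^ 2`. Halving also lets `x` range over the closed interval `[-ε, ε]`. -/
theorem norm_sq_le_of_symmetric (hε : 0 < ε)
    (hu : ∀ n, ∀ t ∈ Ioo (-ε) ε, HasDerivAt (u n) (u (n + 1) t) t)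
    (hsym : ∀ s ∈ Ioo (-ε) ε, ∀ t ∈ Ioo (-ε) ε, ⟪u 1 s, u 0 t⟫_ℂ = ⟪u 0 s, u 1 t⟫_ℂ) (n : ℕ) :
    2 * ‖u n 0‖ ^ 2 * (ε ^ (2 * n) / (2 * n).factorial)
      ≤ ‖u 0 (ε / 2)‖ ^ 2 + ‖u 0 (-ε / 2)‖ ^ 2 := by
  have hank := hankel_of_symmetric hu hsym
  have hadd : ∀ n m, ∀ s ∈ Ioo (-ε) ε, ⟪u (m + n) s, u 0 s⟫_ℂ = ⟪u m s, u n s⟫_ℂ := by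
    intro n
    induction n with
    | zero => intro m s hs; rfl
    | succ n ih =>
      intro m s hs
      rw [← hank m n s hs s hs, ← ih (m + 1) s hs, show m + (n + 1) = m + 1 + n by ring]
  have hhalf : ∀ x ∈ Icc (-ε) ε, x / 2 ∈ Ioo (-ε) ε := fun x hx =>
    ⟨by linarith [hx.1], by linarith [hx.2]⟩
  have hsq : ∀ j, ∀ x ∈ Ioo (-ε) ε, (⟪u (2 * j) x, u 0 x⟫_ℂ).re = ‖u j x‖ ^ 2 := by
    intro j x hx
    rw [two_mul, hadd j j x hx]
    exact inner_self_eq_norm_sq (𝕜 := ℂ) (u j x)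
  have h := even_deriv_le (S := fun j x => (⟪u j (x / 2), u 0 (x / 2)⟫_ℂ).re) hε.le ?_ ?_ n
  · have h0 : (0 : ℝ) ∈ Ioo (-ε) ε := ⟨by linarith, hε⟩
    rw [← hsq n 0 h0, ← hsq 0 _ (hhalf ε ⟨by linarith, le_rfl⟩),
      ← hsq 0 _ (hhalf (-ε) ⟨le_rfl, by linarith⟩)]
    simpa using h
  · intro j x hx
    have h1 : HasDerivAt (fun x : ℝ => x / 2) (1 / 2) x := (hasDerivAt_id x).div_const 2
    have h2 : ∀ n, HasDerivAt (fun x => u n (x / 2)) ((1 / 2 : ℝ) • u (n + 1) (x / 2)) x :=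
      fun n => (hu n (x / 2) (hhalf x hx)).scomp x h1
    have h3 := Complex.reCLM.hasFDerivAt.comp_hasDerivAt x ((h2 j).inner ℂ (h2 0))
    refine h3.congr_deriv ?_
    rw [← Complex.coe_smul, ← Complex.coe_smul, inner_smul_right, inner_smul_left,
      ← hank j 0 _ (hhalf x hx) _ (hhalf x hx), Complex.conj_ofReal, ← add_mul]
    norm_num
  · intro j x hx
    rw [hsq j _ (hhalf x hx)]
    positivity

theorem isAnalyticChain_of_symmetric (hε : 0 < ε)
    (hu : ∀ n, ∀ t ∈ Ioo (-ε) ε, HasDerivAt (u n) (u (n + 1) t) t)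
    (hsym : ∀ s ∈ Ioo (-ε) ε, ∀ t ∈ Ioo (-ε) ε, ⟪u 1 s, u 0 t⟫_ℂ = ⟪u 0 s, u 1 t⟫_ℂ) :
    IsAnalyticChain (Real.sqrt (‖u 0 (ε / 2)‖ ^ 2 + ‖u 0 (-ε / 2)‖ ^ 2)) (ε / 2)
      (fun n => u n 0) := by
  have h0 : (0 : ℝ) ∈ Ioo (-ε) ε := ⟨by linarith, hε⟩
  refine ⟨fun m n => hankel_of_symmetric hu hsym m n 0 h0 0 h0, fun n => ?_⟩
  have h := norm_sq_le_of_symmetric hε hu hsym n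
  set C := ‖u 0 (ε / 2)‖ ^ 2 + ‖u 0 (-ε / 2)‖ ^ 2 with hC
  have hC0 : 0 ≤ C := by positivity
  refine le_of_sq_le_sq ?_ (by positivity)
  rw [div_pow, mul_pow, Real.sq_sqrt hC0, le_div_iff₀ (by positivity), div_pow, div_pow]
  -- The factor `4 ^ n`, after a square root, is what reduces the radius from `ε` to `ε / 2`.
  have hfac : ((2 * n).factorial : ℝ) ≤ 4 ^ n * (n.factorial : ℝ) ^ 2 := by
    have h2 := Nat.add_choose_mul_factorial_mul_factorial n n
    have h3 := Nat.choose_le_two_pow (n + n) n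
    rw [two_mul, ← h2]
    push_cast
    rw [mul_assoc, sq, show (4 : ℝ) ^ n = 2 ^ (n + n) by rw [← two_mul, pow_mul]; norm_num]
    gcongr
    exact_mod_cast h3
  rw [← mul_div_assoc, div_le_iff₀ (by positivity)] at h
  rw [← mul_div_assoc, div_le_iff₀ (by positivity), ← pow_mul, ← pow_mul, mul_comm n 2]
  calc _ ≤ 2 * ‖u n 0‖ ^ 2 * ε ^ (2 * n) := by
        have : 0 ≤ ‖u n 0‖ ^ 2 * ε ^ (2 * n) := by positivity
        linarith
    _ ≤ C * (2 * n).factorial := h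
    _ ≤ C * (4 ^ n * (n.factorial : ℝ) ^ 2) := by gcongr
    _ = _ := by rw [pow_mul]; norm_num; ring

/-- A symmetric flow is orthogonal to every vector that behaves like an eigenvector with eigenvalue
`i` or `-i` along the flow. -/
theorem inner_eq_zero_of_symmetric_flow [CompleteSpace H] (hε : 0 < ε)
    (hu : ∀ n, ∀ t ∈ Ioo (-ε) ε, HasDerivAt (u n) (u (n + 1) t) t)
    (hsym : ∀ s ∈ Ioo (-ε) ε, ∀ t ∈ Ioo (-ε) ε, ⟪u 1 s, u 0 t⟫_ℂ = ⟪u 0 s, u 1 t⟫_ℂ)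
    {φ : H} {σ : ℝ} (hσ : σ ^ 2 = 1)
    (hφ : ∀ t ∈ Ioo (-ε) ε, ⟪φ, u 1 t⟫_ℂ = -(Complex.I * σ) * ⟪φ, u 0 t⟫_ℂ) :
    ⟪φ, u 0 0⟫_ℂ = 0 := by
  -- Differentiating the eigenvalue relation along the flow propagates it to all orders.
  have hall : ∀ n, ∀ t ∈ Ioo (-ε) ε, ⟪φ, u (n + 1) t⟫_ℂ = -(Complex.I * σ) * ⟪φ, u n t⟫_ℂ := by
    have hd : ∀ n, ∀ t ∈ Ioo (-ε) ε, HasDerivAt (fun t => ⟪φ, u n t⟫_ℂ) ⟪φ, u (n + 1) t⟫_ℂ t := by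
      intro n t ht
      simpa using (hasDerivAt_const t φ).inner ℂ (hu n t ht)
    intro n
    induction n with
    | zero => exact hφ
    | succ n ih =>
      intro t ht
      exact (hd (n + 1) t ht).unique (((hd n t ht).const_mul _).congr_of_eventuallyEq
        (Filter.eventually_of_mem (isOpen_Ioo.mem_nhds ht) ih))
  exact (isAnalyticChain_of_symmetric hε hu hsym).inner_eq_zero (by positivity) hσ
    fun n => hall n 0 ⟨by linarith, hε⟩

end SymmetricFlow

/-! ### Essential self-adjointness from trivial deficiency -/

section SelfAdjointness

open LinearPMap

variable {H : Type*} [NormedAddCommGroup H] [InnerProductSpace ℂ H]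
  {T : H →ₗ.[ℂ] H}

/-- A symmetric operator has no non-real approximate eigenvalues. -/
theorem norm_sq_add_smul_I (hT : T.IsFormalAdjoint T) {σ : ℝ} (hσ : σ ^ 2 = 1) (x : T.domain) :
    ‖T x + (Complex.I * σ) • (x : H)‖ ^ 2 = ‖T x‖ ^ 2 + ‖(x : H)‖ ^ 2 := by
  have h1 : ⟪T x, (x : H)⟫_ℂ = ⟪(x : H), T x⟫_ℂ := hT x x
  have h2 : (⟪(x : H), T x⟫_ℂ).im = 0 := by
    rw [← inner_conj_symm] at h1
    exact Complex.conj_eq_iff_im.1 h1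
  rw [norm_add_sq (𝕜 := ℂ), inner_smul_right, h1, norm_smul, mul_pow, norm_mul, Complex.norm_I,
    Complex.norm_real, one_mul, Real.norm_eq_abs, sq_abs, hσ]
  simp [h2]

variable [CompleteSpace H]

/-- The vectors orthogonal to the ranges of `T + i` and of `T - i` vanish. -/
def HasTrivialDeficiency (T : H →ₗ.[ℂ] H) : Prop :=
  ∀ σ : ℝ, σ ^ 2 = 1 → ∀ φ : H, (∀ x : T.domain, ⟪φ, T x⟫_ℂ = -(Complex.I * σ) * ⟪φ, (x : H)⟫_ℂ) →
    φ = 0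

theorem isClosable_of_symmetric (hd : Dense (T.domain : Set H)) (hT : T.IsFormalAdjoint T) :
    T.IsClosable :=
  isClosable_iff_exists_closed_extension.2 ⟨T†, adjoint_isClosed hd, hT.le_adjoint hd⟩

/-- Trivial deficiency makes the range of `T + iσ` dense. By the identity `‖(T + iσ) x‖ ^ 2 = ‖T x‖
^ 2 + ‖x‖ ^ 2`, convergence of the images forces both `ψ n` and `T (ψ n)` to converge, so the limit
is attained by the closure. -/
theorem exists_closure_add_smul_eq (hd : Dense (T.domain : Set H)) (hT : T.IsFormalAdjoint T)
    (hdef : HasTrivialDeficiency T) {σ : ℝ} (hσ : σ ^ 2 = 1) (h : H) :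
    ∃ x : T.closure.domain, T.closure x + (Complex.I * σ) • (x : H) = h := by
  let L : T.domain →ₗ[ℂ] H := T.toFun + (Complex.I * σ : ℂ) • T.domain.subtype
  have hL : ∀ x, L x = T x + (Complex.I * σ) • (x : H) := fun x => rfl
  have hdense : (LinearMap.range L).topologicalClosure = ⊤ := by
    rw [Submodule.topologicalClosure_eq_top_iff, Submodule.eq_bot_iff]
    intro φ hφ
    refine hdef σ hσ φ fun x => ?_
    have h1 := (Submodule.mem_orthogonal' _ _).1 hφ (L x) ⟨x, rfl⟩
    rw [hL, inner_add_right, inner_smul_right] at h1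
    linear_combination h1
  have hmem : h ∈ closure (LinearMap.range L : Set H) := by
    rw [← Submodule.topologicalClosure_coe, hdense]
    trivial
  obtain ⟨w, hw, hlim⟩ := mem_closure_iff_seq_limit.1 hmem
  choose ψ hψ using hw
  have hsq : ∀ n m, ‖w n - w m‖ ^ 2 = ‖T (ψ n) - T (ψ m)‖ ^ 2 + ‖(ψ n : H) - ψ m‖ ^ 2 := by
    intro n m
    rw [← hψ, ← hψ, ← _root_.map_sub, hL, norm_sq_add_smul_I hT hσ, LinearPMap.map_sub]
    rfl
  have hwc : Tendsto (fun p : ℕ × ℕ => ‖w p.1 - w p.2‖) atTop (𝓝 0) := by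
    simpa [dist_eq_norm] using cauchySeq_iff_tendsto_dist_atTop_0.1 hlim.cauchySeq
  have c1 : CauchySeq fun n => (ψ n : H) := by
    rw [cauchySeq_iff_tendsto_dist_atTop_0]
    refine squeeze_zero (fun _ => dist_nonneg) (fun p => ?_) hwc
    rw [dist_eq_norm]
    refine le_of_sq_le_sq ?_ (norm_nonneg _)
    rw [hsq]
    exact le_add_of_nonneg_left (by positivity)
  have c2 : CauchySeq fun n => T (ψ n) := by
    rw [cauchySeq_iff_tendsto_dist_atTop_0]
    refine squeeze_zero (fun _ => dist_nonneg) (fun p => ?_) hwc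
    rw [dist_eq_norm]
    refine le_of_sq_le_sq ?_ (norm_nonneg _)
    rw [hsq]
    exact le_add_of_nonneg_right (by positivity)
  obtain ⟨x, hx⟩ := cauchySeq_tendsto_of_complete c1
  obtain ⟨y, hy⟩ := cauchySeq_tendsto_of_complete c2
  have hg : (x, y) ∈ T.closure.graph := by
    rw [← (isClosable_of_symmetric hd hT).graph_closure_eq_closure_graph, ← SetLike.mem_coe,
      Submodule.topologicalClosure_coe]
    exact mem_closure_of_tendsto (hx.prodMk_nhds hy)
      (Filter.Eventually.of_forall fun n => T.mem_graph (ψ n))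
  obtain ⟨z, hz1, hz2⟩ := (mem_graph_iff _).1 hg
  refine ⟨z, ?_⟩
  dsimp only at hz1 hz2
  rw [hz1, hz2]
  refine tendsto_nhds_unique (hy.add (hx.const_smul _)) ?_
  refine hlim.congr fun n => ?_
  rw [← hψ, hL]

/-- An operator with trivial deficiency spaces is essentially self-adjoint, and its closure is its
adjoint. -/
theorem closure_eq_adjoint (hd : Dense (T.domain : Set H)) (hT : T.IsFormalAdjoint T)
    (hdef : HasTrivialDeficiency T) : T.closure = T† := by
  have hle : T.closure ≤ T† := by
    refine le_of_le_graph ?_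
    rw [← (isClosable_of_symmetric hd hT).graph_closure_eq_closure_graph]
    exact Submodule.topologicalClosure_minimal _ (le_graph_of_le (hT.le_adjoint hd))
      (adjoint_isClosed hd)
  refine le_antisymm hle ⟨fun φ hφ => ?_, fun x y hxy => (hle.2 hxy.symm).symm⟩
  -- Choose `ψ` in the domain of the closure with the same image as `φ` under `T† + i`. Then `φ - ψ`
  -- lies in the kernel of `T† + i`, so it is orthogonal to the range of `T - i`; this explains the
  -- value `-1` below.
  obtain ⟨ψ, hψ⟩ := exists_closure_add_smul_eq hd hT hdef (σ := 1) (by norm_num)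
    (T† ⟨φ, hφ⟩ + (Complex.I * (1 : ℝ)) • φ)
  let ψ' : T†.domain := ⟨ψ, hle.1 ψ.2⟩
  have h1 : T† ψ' = T.closure ψ := (hle.2 rfl).symm
  have h2 : φ - ψ = 0 := by
    refine hdef (-1) (by norm_num) _ fun x => ?_
    have h3 : T† (⟨φ, hφ⟩ - ψ') = -(Complex.I • (φ - ψ)) := by
      rw [LinearPMap.map_sub, h1, smul_sub]
      simp only [Complex.ofReal_one, mul_one] at hψ
      rw [← sub_eq_zero]
      have := sub_eq_zero.2 hψ
      rw [← neg_eq_zero]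
      convert this using 1
      abel
    have h4 := adjoint_isFormalAdjoint hd (⟨φ, hφ⟩ - ψ') x
    rw [h3] at h4
    have h5 : ((⟨φ, hφ⟩ - ψ' : T†.domain) : H) = φ - ψ := rfl
    rw [h5, inner_neg_left, inner_smul_left, Complex.conj_I] at h4
    rw [← h4]
    push_cast
    ring
  rw [sub_eq_zero.1 h2]
  exact ψ.2

theorem closure_symmetric (hd : Dense (T.domain : Set H)) (hT : T.IsFormalAdjoint T)
    (hdef : HasTrivialDeficiency T) : T.closure.IsFormalAdjoint T.closure := by
  intro x y
  have hcl : IsClosed {p : H × H | ⟪T.closure x, p.1⟫_ℂ = ⟪(x : H), p.2⟫_ℂ} :=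
    isClosed_eq (by fun_prop) (by fun_prop)
  have hsub : (T.graph.topologicalClosure : Set (H × H)) ⊆
      {p : H × H | ⟪T.closure x, p.1⟫_ℂ = ⟪(x : H), p.2⟫_ℂ} := by
    rw [Submodule.topologicalClosure_coe]
    refine hcl.closure_subset_iff.2 ?_
    intro p hp
    obtain ⟨z, hz1, hz2⟩ := (mem_graph_iff _).1 hp
    have hx : (x : H) ∈ T†.domain := (closure_eq_adjoint hd hT hdef).le.1 x.2
    have h1 : T.closure x = T† ⟨x, hx⟩ := (closure_eq_adjoint hd hT hdef).le.2 rfl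
    change ⟪T.closure x, p.1⟫_ℂ = ⟪(x : H), p.2⟫_ℂ
    rw [← hz1, ← hz2, h1]
    exact adjoint_isFormalAdjoint hd ⟨x, hx⟩ z
  rw [(isClosable_of_symmetric hd hT).graph_closure_eq_closure_graph] at hsub
  exact hsub (T.closure.mem_graph y)

theorem isEssentiallySelfAdjoint_of_hasTrivialDeficiency (hd : Dense (T.domain : Set H))
    (hT : T.IsFormalAdjoint T) (hdef : HasTrivialDeficiency T) : IsEssentiallySelfAdjoint T := by
  refine ⟨hd, hT, ?_⟩
  rw [isSelfAdjoint_def]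
  have hd' : Dense (T.closure.domain : Set H) := hd.mono T.le_closure.1
  refine le_antisymm ?_ ((closure_symmetric hd hT hdef).le_adjoint hd')
  conv_rhs => rw [closure_eq_adjoint hd hT hdef]
  -- The adjoint of the closure is contained in `T†`, which is the closure.
  refine IsFormalAdjoint.le_adjoint hd (IsFormalAdjoint.symm fun y x => ?_)
  have h1 := adjoint_isFormalAdjoint hd' y ⟨x, T.le_closure.1 x.2⟩
  have h2 : T x = T.closure ⟨x, T.le_closure.1 x.2⟩ := T.le_closure.2 rfl
  rw [h2]
  exact h1

end SelfAdjointness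

/-! ### Measures attached to a representation of `C(X, ℂ)` -/

section SpectralIntegral

variable {X : Type*} [MetricSpace X] [CompactSpace X] [MeasurableSpace X] [BorelSpace X]
  {H : Type*} [NormedAddCommGroup H] [InnerProductSpace ℂ H] [CompleteSpace H]
  (π : C(X, ℂ) →⋆ₐ[ℂ] (H →L[ℂ] H))

/-- A real continuous function as a complex valued one. -/
def complexify (f : C(X, ℝ)) : C(X, ℂ) := ⟨fun a => (f a : ℂ), by fun_prop⟩

omit [CompactSpace X] [MeasurableSpace X] [BorelSpace X] in
@[simp]
theorem complexify_apply (f : C(X, ℝ)) (a : X) : complexify f a = f a := rfl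

omit [CompactSpace X] [MeasurableSpace X] [BorelSpace X] in
theorem exists_complexify_add (g : C(X, ℂ)) :
    ∃ f₁ f₂ : C(X, ℝ), g = complexify f₁ + Complex.I • complexify f₂ :=
  ⟨⟨fun a => (g a).re, by fun_prop⟩, ⟨fun a => (g a).im, by fun_prop⟩, by
    ext a
    simp [mul_comm Complex.I, Complex.re_add_im]⟩

variable {π} in
omit [CompactSpace X] [MeasurableSpace X] [BorelSpace X] in
theorem inner_map_left (g : C(X, ℂ)) (x y : H) : ⟪π g x, y⟫_ℂ = ⟪x, π (star g) y⟫_ℂ := by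
  rw [map_star, ContinuousLinearMap.star_eq_adjoint, ContinuousLinearMap.adjoint_inner_right]

variable {π} in
omit [CompactSpace X] [MeasurableSpace X] [BorelSpace X] in
theorem inner_map_map (g h : C(X, ℂ)) (x : H) : ⟪π g x, π h x⟫_ℂ = ⟪x, π (star g * h) x⟫_ℂ := by
  rw [inner_map_left, map_mul]
  rfl

/-- The positive functional `f ↦ ⟪x, π(f) x⟫` on the real continuous functions. -/
def vectorFunctional (x : H) : CompactlySupportedContinuousMap X ℝ →ₚ[ℝ] ℝ :=
  PositiveLinearMap.mk₀
    { toFun := fun f => (⟪x, π (complexify f.toContinuousMap) x⟫_ℂ).re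
      map_add' := fun f g => by
        have : complexify (f + g).toContinuousMap
            = complexify f.toContinuousMap + complexify g.toContinuousMap := by
          ext a; simp
        rw [this, map_add, add_apply, inner_add_right, Complex.add_re]
      map_smul' := fun c f => by
        have : complexify (c • f).toContinuousMap
            = (c : ℂ) • complexify f.toContinuousMap := by
          ext a; simp
        rw [this, map_smul, smul_apply, inner_smul_right]
        simp }
    (fun f hf => by
      -- Positivity: `f = star s * s`, so the functional has the value `‖π s x‖ ^ 2`.
      let s : C(X, ℂ) := ⟨fun a => (Real.sqrt (f a) : ℂ), by fun_prop⟩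
      have hs : complexify f.toContinuousMap = star s * s := by
        ext a
        have h0 : 0 ≤ f a := hf a
        simp only [complexify_apply, ContinuousMap.mul_apply, ContinuousMap.star_apply, s,
          ContinuousMap.coe_mk, RCLike.star_def, Complex.conj_ofReal]
        rw [← Complex.ofReal_mul, Real.mul_self_sqrt h0]
        rfl
      change 0 ≤ (⟪x, π (complexify f.toContinuousMap) x⟫_ℂ).re
      rw [hs, ← inner_map_map]
      exact inner_self_nonneg (𝕜 := ℂ))

/-- The measure representing `f ↦ ⟪x, π(f) x⟫`. -/
def vectorMeasure (x : H) : Measure X := RealRMK.rieszMeasure (vectorFunctional π x)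

instance (x : H) : IsFiniteMeasure (vectorMeasure π x) := by
  unfold vectorMeasure
  infer_instance

theorem integrable_continuousMap {F : Type*} [NormedAddCommGroup F] [SecondCountableTopology F]
    (μ : Measure X) [IsFiniteMeasure μ]
    (g : C(X, F)) : Integrable g μ :=
  g.continuous.integrable_of_hasCompactSupport (HasCompactSupport.of_compactSpace _)

theorem memLp_continuousMap (μ : Measure X) [IsFiniteMeasure μ] (g : C(X, ℂ)) : MemLp g 2 μ :=
  MemLp.of_bound g.continuous.aestronglyMeasurable ‖g‖ (ae_of_all _ g.norm_coe_le_norm)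

theorem integral_vectorMeasure (x : H) (g : C(X, ℂ)) :
    ∫ a, g a ∂(vectorMeasure π x) = ⟪x, π g x⟫_ℂ := by
  have hreal : ∀ f : C(X, ℝ), ∫ a, complexify f a ∂(vectorMeasure π x)
      = ⟪x, π (complexify f) x⟫_ℂ := by
    intro f
    have h1 := RealRMK.integral_rieszMeasure (vectorFunctional π x)
      (CompactlySupportedContinuousMap.continuousMapEquiv f)
    have h2 : conj ⟪x, π (complexify f) x⟫_ℂ = ⟪x, π (complexify f) x⟫_ℂ := by
      rw [inner_conj_symm, inner_map_left]
      congr 3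
      ext a
      simp
    simp only [complexify_apply]
    rw [integral_complex_ofReal, ← Complex.conj_eq_iff_re.1 h2]
    congr 1
  obtain ⟨f₁, f₂, rfl⟩ := exists_complexify_add g
  simp only [ContinuousMap.add_apply, ContinuousMap.smul_apply, map_add, map_smul, add_apply,
    smul_apply, inner_add_right, inner_smul_right]
  have hadd := integral_add (integrable_continuousMap (vectorMeasure π x) (complexify f₁))
    ((integrable_continuousMap (vectorMeasure π x) (complexify f₂)).smul Complex.I)
  simp only [Pi.smul_apply] at hadd
  rw [hadd, integral_smul, hreal, hreal]
  rfl

omit [CompactSpace X] in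
theorem measure_ext_of_continuousMap {μ ν : Measure X} [IsFiniteMeasure μ] [IsFiniteMeasure ν]
    (h : ∀ g : C(X, ℂ), ∫ a, g a ∂μ = ∫ a, g a ∂ν) : μ = ν := by
  refine ext_of_forall_integral_eq_of_IsFiniteMeasure fun f => ?_
  have := h (complexify f.toContinuousMap)
  simp only [complexify_apply] at this
  rw [integral_complex_ofReal, integral_complex_ofReal] at this
  exact Complex.ofReal_injective this

theorem eq_vectorMeasure {μ : Measure X} [IsFiniteMeasure μ] {x : H}
    (h : ∀ g : C(X, ℂ), ∫ a, g a ∂μ = ⟪x, π g x⟫_ℂ) : μ = vectorMeasure π x :=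
  measure_ext_of_continuousMap fun g => by rw [h, integral_vectorMeasure]

/-- Its use is domination: the measure of `x + y` is bounded by twice the sum of those of `x` and
`y`, so the domain of an unbounded function of the operator is closed under addition. -/
theorem vectorMeasure_parallelogram (x y : H) :
    vectorMeasure π (x + y) + vectorMeasure π (x - y)
      = (2 : NNReal) • vectorMeasure π x + (2 : NNReal) • vectorMeasure π y := by
  refine measure_ext_of_continuousMap fun g => ?_
  have hi : ∀ z, Integrable g (vectorMeasure π z) := fun z => integrable_continuousMap _ g
  rw [integral_add_measure (hi _) (hi _),
    integral_add_measure ((hi _).smul_measure_nnreal) ((hi _).smul_measure_nnreal),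
    integral_smul_nnreal_measure, integral_smul_nnreal_measure]
  simp only [integral_vectorMeasure, map_add, map_sub, inner_add_left, inner_add_right,
    inner_sub_left, inner_sub_right, NNReal.smul_def]
  simp only [NNReal.coe_ofNat, Complex.real_smul, Complex.ofReal_ofNat]
  ring

theorem vectorMeasure_smul (c : ℂ) (x : H) :
    vectorMeasure π (c • x) = (‖c‖₊ ^ 2 : NNReal) • vectorMeasure π x := by
  refine measure_ext_of_continuousMap fun g => ?_
  rw [integral_smul_nnreal_measure]
  simp only [integral_vectorMeasure, map_smul, inner_smul_left, inner_smul_right, NNReal.smul_def]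
  rw [← mul_assoc, Complex.real_smul]
  push_cast
  rw [Complex.mul_conj']

theorem exists_continuousMap_tendsto {μ : Measure X} [IsFiniteMeasure μ] {f : X → ℂ}
    (hf : MemLp f 2 μ) :
    ∃ g : ℕ → C(X, ℂ), Tendsto (fun n => eLpNorm (⇑(g n) - f) 2 μ) atTop (𝓝 0) := by
  have h := fun n : ℕ => hf.exists_boundedContinuous_eLpNorm_sub_le (by simp)
    (ε := ((n : ENNReal) + 1)⁻¹) (by simp)
  choose g hg _ using h
  refine ⟨fun n => (g n).toContinuousMap, ?_⟩
  refine tendsto_of_tendsto_of_tendsto_of_le_of_le tendsto_const_nhds ?_ (fun _ => zero_le)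
    (fun n => (eLpNorm_sub_comm _ _ _ _).trans_le (hg n))
  refine (ENNReal.tendsto_inv_nat_nhds_zero.comp (tendsto_add_atTop_nat 1)).congr fun n => ?_
  simp

end SpectralIntegral

/-! ### Functional calculus for square integrable functions -/

section SpectralIntegral

variable {X : Type*} [MetricSpace X] [CompactSpace X] [MeasurableSpace X] [BorelSpace X]
  {H : Type*} [NormedAddCommGroup H] [InnerProductSpace ℂ H] [CompleteSpace H]
  (π : C(X, ℂ) →⋆ₐ[ℂ] (H →L[ℂ] H))

/-- The map `g ↦ π(g) x`. -/
def orbitMap (x : H) : C(X, ℂ) →ₗ[ℂ] H where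
  toFun g := π g x
  map_add' f g := by rw [map_add, add_apply]
  map_smul' c g := by rw [map_smul, smul_apply, RingHom.id_apply]

theorem inner_orbitMap (x : H) (f g : C(X, ℂ)) :
    ⟪π f x, π g x⟫_ℂ = ⟪ContinuousMap.toLp 2 (vectorMeasure π x) ℂ f,
      ContinuousMap.toLp 2 (vectorMeasure π x) ℂ g⟫_ℂ := by
  rw [ContinuousMap.inner_toLp, inner_map_map, ← integral_vectorMeasure]
  refine integral_congr_ae (ae_of_all _ fun a => ?_)
  simp [mul_comm]

theorem norm_orbitMap (x : H) (g : C(X, ℂ)) :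
    ‖orbitMap π x g‖ = ‖ContinuousMap.toLp 2 (vectorMeasure π x) ℂ g‖ := by
  have h := inner_orbitMap π x g g
  rw [inner_self_eq_norm_sq_to_K, inner_self_eq_norm_sq_to_K] at h
  have h2 : ‖π g x‖ ^ 2 = ‖ContinuousMap.toLp 2 (vectorMeasure π x) ℂ g‖ ^ 2 := by exact_mod_cast h
  exact (pow_left_inj₀ (norm_nonneg _) (norm_nonneg _) two_ne_zero).1 h2

theorem denseRange_toLp (x : H) :
    DenseRange (ContinuousMap.toLp 2 (vectorMeasure π x) ℂ :
      C(X, ℂ) →L[ℂ] Lp ℂ 2 (vectorMeasure π x)) :=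
  ContinuousMap.toLp_denseRange ℂ _ ℂ (by simp)

/-- The isometry of the space of square integrable functions onto the cyclic subspace of `x`. -/
def cyclicMap (x : H) : Lp ℂ 2 (vectorMeasure π x) →L[ℂ] H :=
  (orbitMap π x).extendOfNorm
    (ContinuousMap.toLp 2 (vectorMeasure π x) ℂ :
      C(X, ℂ) →L[ℂ] Lp ℂ 2 (vectorMeasure π x)).toLinearMap

theorem cyclicMap_toLp (x : H) (g : C(X, ℂ)) :
    cyclicMap π x (ContinuousMap.toLp 2 (vectorMeasure π x) ℂ g) = π g x :=
  LinearMap.extendOfNorm_eq (denseRange_toLp π x)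
    ⟨1, fun g => by rw [one_mul]; exact (norm_orbitMap π x g).le⟩ g

theorem inner_cyclicMap (x : H) (f g : Lp ℂ 2 (vectorMeasure π x)) :
    ⟪cyclicMap π x f, cyclicMap π x g⟫_ℂ = ⟪f, g⟫_ℂ := by
  refine (denseRange_toLp π x).induction_on₂ (isClosed_eq (by fun_prop) (by fun_prop)) ?_ f g
  intro f g
  rw [cyclicMap_toLp, cyclicMap_toLp, inner_orbitMap]

open Classical in
/-- The vector `f(A) x` for a square integrable function `f`. -/
def spectralVector (x : H) (f : X → ℂ) : H :=
  if h : MemLp f 2 (vectorMeasure π x) then cyclicMap π x (h.toLp f) else 0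

variable {π} {x : H} {f g h : X → ℂ}

theorem spectralVector_of_memLp (hf : MemLp f 2 (vectorMeasure π x)) :
    spectralVector π x f = cyclicMap π x (hf.toLp f) := dif_pos hf

theorem spectralVector_continuousMap (x : H) (g : C(X, ℂ)) : spectralVector π x g = π g x := by
  rw [spectralVector_of_memLp (memLp_continuousMap _ g), ← cyclicMap_toLp]
  rfl

theorem tendsto_spectralVector (hf : MemLp f 2 (vectorMeasure π x)) {ι : Type*} {l : Filter ι}
    {F : ι → X → ℂ} (hF : ∀ n, MemLp (F n) 2 (vectorMeasure π x))
    (hlim : Tendsto (fun n => eLpNorm (F n - f) 2 (vectorMeasure π x)) l (𝓝 0)) :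
    Tendsto (fun n => spectralVector π x (F n)) l (𝓝 (spectralVector π x f)) := by
  rw [spectralVector_of_memLp hf]
  simp_rw [fun n => spectralVector_of_memLp (hF n)]
  exact ((cyclicMap π x).continuous.tendsto _).comp
    ((Lp.tendsto_Lp_iff_tendsto_eLpNorm'' F hF f hf).2 hlim)

theorem tendsto_map_apply (hf : MemLp f 2 (vectorMeasure π x)) {F : ℕ → C(X, ℂ)}
    (hlim : Tendsto (fun n => eLpNorm (⇑(F n) - f) 2 (vectorMeasure π x)) atTop (𝓝 0)) :
    Tendsto (fun n => π (F n) x) atTop (𝓝 (spectralVector π x f)) := by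
  simpa only [spectralVector_continuousMap] using
    tendsto_spectralVector hf (fun n => memLp_continuousMap _ (F n)) hlim

theorem spectralVector_congr (hfg : f =ᵐ[vectorMeasure π x] g) :
    spectralVector π x f = spectralVector π x g := by
  by_cases hf : MemLp f 2 (vectorMeasure π x)
  · have hg := hf.ae_eq hfg
    rw [spectralVector_of_memLp hf, spectralVector_of_memLp hg,
      MemLp.toLp_congr hf hg hfg]
  · have hg : ¬ MemLp g 2 (vectorMeasure π x) := fun hg => hf (hg.ae_eq hfg.symm)
    rw [spectralVector, spectralVector, dif_neg hf, dif_neg hg]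

theorem spectralVector_add (hf : MemLp f 2 (vectorMeasure π x))
    (hg : MemLp g 2 (vectorMeasure π x)) :
    spectralVector π x (f + g) = spectralVector π x f + spectralVector π x g := by
  rw [spectralVector_of_memLp hf, spectralVector_of_memLp hg, spectralVector_of_memLp (hf.add hg),
    MemLp.toLp_add, map_add]

theorem spectralVector_const_smul (c : ℂ) (hf : MemLp f 2 (vectorMeasure π x)) :
    spectralVector π x (c • f) = c • spectralVector π x f := by
  rw [spectralVector_of_memLp hf, spectralVector_of_memLp (hf.const_smul c),
    MemLp.toLp_const_smul, map_smul]

theorem spectralVector_sub (hf : MemLp f 2 (vectorMeasure π x))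
    (hg : MemLp g 2 (vectorMeasure π x)) :
    spectralVector π x (f - g) = spectralVector π x f - spectralVector π x g := by
  rw [spectralVector_of_memLp hf, spectralVector_of_memLp hg, spectralVector_of_memLp (hf.sub hg),
    MemLp.toLp_sub, map_sub]

theorem inner_spectralVector (hf : MemLp f 2 (vectorMeasure π x))
    (hg : MemLp g 2 (vectorMeasure π x)) :
    ⟪spectralVector π x f, spectralVector π x g⟫_ℂ
      = ∫ a, conj (f a) * g a ∂(vectorMeasure π x) := by
  rw [spectralVector_of_memLp hf, spectralVector_of_memLp hg, inner_cyclicMap, L2.inner_def]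
  refine integral_congr_ae ?_
  filter_upwards [hf.coeFn_toLp, hg.coeFn_toLp] with a h1 h2
  rw [h1, h2]
  simp [mul_comm]

theorem spectralVector_one (x : H) : spectralVector π x (fun _ => 1) = x := by
  have := spectralVector_continuousMap (π := π) x 1
  rw [map_one] at this
  exact this

theorem inner_self_spectralVector (hf : MemLp f 2 (vectorMeasure π x)) :
    ⟪x, spectralVector π x f⟫_ℂ = ∫ a, f a ∂(vectorMeasure π x) := by
  have h := inner_spectralVector (memLp_const (1 : ℂ)) hf
  rw [spectralVector_one] at h
  simpa using h

theorem norm_spectralVector (hf : MemLp f 2 (vectorMeasure π x)) :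
    ‖spectralVector π x f‖ = (eLpNorm f 2 (vectorMeasure π x)).toReal := by
  rw [← Lp.norm_toLp f hf, spectralVector_of_memLp hf]
  have h := inner_cyclicMap π x (hf.toLp f) (hf.toLp f)
  rw [inner_self_eq_norm_sq_to_K, inner_self_eq_norm_sq_to_K] at h
  have h2 : ‖cyclicMap π x (hf.toLp f)‖ ^ 2 = ‖hf.toLp f‖ ^ 2 := by exact_mod_cast h
  exact (pow_left_inj₀ (norm_nonneg _) (norm_nonneg _) two_ne_zero).1 h2

theorem eLpNorm_spectralVector (hf : MemLp f 2 (vectorMeasure π x)) :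
    ENNReal.ofReal (‖spectralVector π x f‖ ^ 2) = ∫⁻ a, ‖f a‖ₑ ^ 2 ∂(vectorMeasure π x) := by
  rw [norm_spectralVector hf, ← ENNReal.toReal_pow, ENNReal.ofReal_toReal
    (ENNReal.pow_ne_top hf.2.ne), eLpNorm_eq_lintegral_rpow_enorm_toReal (by simp) (by simp),
    ← ENNReal.rpow_natCast, ← ENNReal.rpow_mul]
  norm_num

theorem memLp_continuousMap_mul (u : C(X, ℂ)) {μ : Measure X} (hf : MemLp f 2 μ) :
    MemLp (⇑u * f) 2 μ :=
  hf.of_le_mul (u.continuous.aestronglyMeasurable.mul hf.1) (c := ‖u‖) (ae_of_all _ fun a => by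
    rw [Pi.mul_apply, norm_mul]
    gcongr
    exact u.norm_coe_le_norm a)

/-- Multiplicativity of `π`, extended to `f` by approximation with continuous functions;
multiplication by the bounded `u` preserves convergence in `L²`. -/
theorem map_spectralVector (u : C(X, ℂ)) (hf : MemLp f 2 (vectorMeasure π x)) :
    π u (spectralVector π x f) = spectralVector π x (⇑u * f) := by
  obtain ⟨F, hF⟩ := exists_continuousMap_tendsto hf
  refine tendsto_nhds_unique (((π u).continuous.tendsto _).comp (tendsto_map_apply hf hF)) ?_
  have h1 : Tendsto (fun n => eLpNorm (⇑(u * F n) - ⇑u * f) 2 (vectorMeasure π x)) atTop (𝓝 0) := by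
    have h2 : ∀ n, eLpNorm (⇑(u * F n) - ⇑u * f) 2 (vectorMeasure π x)
        ≤ ENNReal.ofReal ‖u‖ * eLpNorm (⇑(F n) - f) 2 (vectorMeasure π x) := by
      intro n
      refine eLpNorm_le_mul_eLpNorm_of_ae_le_mul (ae_of_all _ fun a => ?_) 2
      have : (⇑(u * F n) - ⇑u * f) a = u a * ((⇑(F n) - f) a) := by
        simp [mul_sub]
      rw [this, norm_mul]
      gcongr
      exact u.norm_coe_le_norm a
    refine tendsto_of_tendsto_of_tendsto_of_le_of_le tendsto_const_nhds ?_ (fun _ => zero_le) h2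
    simpa using ENNReal.Tendsto.const_mul (a := ENNReal.ofReal ‖u‖) hF (Or.inr ENNReal.ofReal_ne_top)
  refine (tendsto_map_apply (memLp_continuousMap_mul u hf) h1).congr fun n => ?_
  rw [map_mul]
  rfl

omit [MetricSpace X] [CompactSpace X] [BorelSpace X] in
theorem lintegral_enorm_sq_lt_top {μ : Measure X} (hf : MemLp f 2 μ) :
    ∫⁻ a, ‖f a‖ₑ ^ 2 ∂μ < ⊤ := by
  have := hf.2
  rw [eLpNorm_lt_top_iff_lintegral_rpow_enorm_lt_top (by simp) (by simp)] at this
  simpa using this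

/-- Both measures give the same integral to every continuous `u`. The density turns square
integrability of `g` at `f(A) x` into that of `g * f` at `x`, which is the correct domain for a
product of unbounded functions. -/
theorem vectorMeasure_spectralVector (hfm : Measurable f) (hf : MemLp f 2 (vectorMeasure π x)) :
    vectorMeasure π (spectralVector π x f)
      = (vectorMeasure π x).withDensity fun a => ‖f a‖ₑ ^ 2 := by
  have hfin : IsFiniteMeasure ((vectorMeasure π x).withDensity fun a => ‖f a‖ₑ ^ 2) :=
    isFiniteMeasure_withDensity (lintegral_enorm_sq_lt_top hf).ne
  symm
  refine eq_vectorMeasure π fun u => ?_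
  rw [map_spectralVector u hf, inner_spectralVector hf (memLp_continuousMap_mul u hf),
    integral_withDensity_eq_integral_toReal_smul (by fun_prop) (ae_of_all _ fun a => by simp)]
  refine integral_congr_ae (ae_of_all _ fun a => ?_)
  simp only [ENNReal.toReal_pow, toReal_enorm, Pi.mul_apply, Complex.real_smul]
  push_cast
  rw [← Complex.conj_mul']
  ring

theorem eLpNorm_vectorMeasure_spectralVector (hfm : Measurable f)
    (hf : MemLp f 2 (vectorMeasure π x)) (hg : Measurable g) :
    eLpNorm g 2 (vectorMeasure π (spectralVector π x f)) = eLpNorm (g * f) 2 (vectorMeasure π x) := by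
  rw [vectorMeasure_spectralVector hfm hf, eLpNorm_eq_lintegral_rpow_enorm_toReal (by simp) (by simp),
    eLpNorm_eq_lintegral_rpow_enorm_toReal (by simp) (by simp),
    lintegral_withDensity_eq_lintegral_mul _ (by fun_prop) (by fun_prop)]
  congr 1
  refine lintegral_congr fun a => ?_
  simp [mul_pow, mul_comm]

theorem memLp_vectorMeasure_spectralVector (hfm : Measurable f)
    (hf : MemLp f 2 (vectorMeasure π x)) (hg : Measurable g) :
    MemLp g 2 (vectorMeasure π (spectralVector π x f)) ↔ MemLp (g * f) 2 (vectorMeasure π x) := by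
  rw [MemLp, MemLp, eLpNorm_vectorMeasure_spectralVector hfm hf hg]
  simp [hg.aestronglyMeasurable, (hg.mul hfm).aestronglyMeasurable]

/-- The functional calculus is multiplicative. -/
theorem spectralVector_spectralVector (hfm : Measurable f)
    (hf : MemLp f 2 (vectorMeasure π x)) (hg : Measurable g)
    (hgf : MemLp (g * f) 2 (vectorMeasure π x)) :
    spectralVector π (spectralVector π x f) g = spectralVector π x (g * f) := by
  have hg' := (memLp_vectorMeasure_spectralVector hfm hf hg).2 hgf
  obtain ⟨F, hF⟩ := exists_continuousMap_tendsto hg'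
  refine tendsto_nhds_unique (tendsto_map_apply hg' hF) ?_
  simp_rw [fun n => map_spectralVector (F n) hf]
  refine tendsto_spectralVector hgf (fun n => memLp_continuousMap_mul _ hf) ?_
  refine hF.congr fun n => ?_
  rw [eLpNorm_vectorMeasure_spectralVector hfm hf ((F n).measurable.sub hg), sub_mul]

omit [MetricSpace X] [CompactSpace X] [BorelSpace X] in
theorem memLp_two_add_measure {μ ν : Measure X} (hμ : MemLp f 2 μ) (hν : MemLp f 2 ν) :
    MemLp f 2 (μ + ν) := by
  have hm : AEStronglyMeasurable f (μ + ν) := hμ.1.add_measure hν.1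
  rw [memLp_two_iff_integrable_sq_norm hm]
  exact ((memLp_two_iff_integrable_sq_norm hμ.1).1 hμ).add_measure
    ((memLp_two_iff_integrable_sq_norm hν.1).1 hν)

theorem memLp_vectorMeasure_add {y : H} (hx : MemLp f 2 (vectorMeasure π x))
    (hy : MemLp f 2 (vectorMeasure π y)) : MemLp f 2 (vectorMeasure π (x + y)) := by
  refine MemLp.left_of_add_measure (ν := vectorMeasure π (x - y)) ?_
  rw [vectorMeasure_parallelogram]
  exact memLp_two_add_measure (hx.smul_measure (by simp)) (hy.smul_measure (by simp))

/-- Approximation in `L²` of the sum of the three measures gives one sequence of continuous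
functions that works for `x`, `y` and `x + y` at once; linearity of each `π (F n)` then passes to
the limit. -/
theorem spectralVector_add_left {y : H} (hx : MemLp f 2 (vectorMeasure π x))
    (hy : MemLp f 2 (vectorMeasure π y)) :
    spectralVector π (x + y) f = spectralVector π x f + spectralVector π y f := by
  have hxy := memLp_vectorMeasure_add hx hy
  obtain ⟨F, hF⟩ := exists_continuousMap_tendsto
    (memLp_two_add_measure (memLp_two_add_measure hx hy) hxy)
  have hle : ∀ {μ : Measure X}, μ ≤ vectorMeasure π x + vectorMeasure π y + vectorMeasure π (x + y) →
      Tendsto (fun n => eLpNorm (⇑(F n) - f) 2 μ) atTop (𝓝 0) := fun hμ =>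
    tendsto_of_tendsto_of_tendsto_of_le_of_le tendsto_const_nhds hF (fun _ => zero_le)
      fun n => eLpNorm_mono_measure _ hμ
  refine tendsto_nhds_unique (tendsto_map_apply hxy (hle (Measure.le_add_left le_rfl))) ?_
  simp_rw [map_add]
  exact (tendsto_map_apply hx (hle (Measure.le_add_right (Measure.le_add_right le_rfl)))).add
    (tendsto_map_apply hy (hle (Measure.le_add_right (Measure.le_add_left le_rfl))))

theorem memLp_vectorMeasure_smul (c : ℂ) (hx : MemLp f 2 (vectorMeasure π x)) :
    MemLp f 2 (vectorMeasure π (c • x)) := by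
  rw [vectorMeasure_smul]
  exact hx.smul_measure (by simp)

theorem spectralVector_smul_left (c : ℂ) (hx : MemLp f 2 (vectorMeasure π x)) :
    spectralVector π (c • x) f = c • spectralVector π x f := by
  have hcx := memLp_vectorMeasure_smul c hx
  obtain ⟨F, hF⟩ := exists_continuousMap_tendsto (memLp_two_add_measure hx hcx)
  have hle : ∀ {μ : Measure X}, μ ≤ vectorMeasure π x + vectorMeasure π (c • x) →
      Tendsto (fun n => eLpNorm (⇑(F n) - f) 2 μ) atTop (𝓝 0) := fun hμ =>
    tendsto_of_tendsto_of_tendsto_of_le_of_le tendsto_const_nhds hF (fun _ => zero_le)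
      fun n => eLpNorm_mono_measure _ hμ
  refine tendsto_nhds_unique (tendsto_map_apply hcx (hle (Measure.le_add_left le_rfl))) ?_
  simp_rw [map_smul]
  exact (tendsto_map_apply hx (hle (Measure.le_add_right le_rfl))).const_smul c

theorem inner_spectralVector_left {y : H} (hx : MemLp f 2 (vectorMeasure π x))
    (hy : MemLp f 2 (vectorMeasure π y)) :
    ⟪spectralVector π x f, y⟫_ℂ = ⟪x, spectralVector π y (star f)⟫_ℂ := by
  obtain ⟨F, hF⟩ := exists_continuousMap_tendsto (memLp_two_add_measure hx hy)
  have hle : ∀ {μ : Measure X}, μ ≤ vectorMeasure π x + vectorMeasure π y →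
      Tendsto (fun n => eLpNorm (⇑(F n) - f) 2 μ) atTop (𝓝 0) := fun hμ =>
    tendsto_of_tendsto_of_tendsto_of_le_of_le tendsto_const_nhds hF (fun _ => zero_le)
      fun n => eLpNorm_mono_measure _ hμ
  have hys : MemLp (star f) 2 (vectorMeasure π y) := hy.star
  have h1 := (tendsto_map_apply hx (hle (Measure.le_add_right le_rfl))).inner
    (tendsto_const_nhds (x := y)) (𝕜 := ℂ)
  have h2 : Tendsto (fun n => eLpNorm (⇑(star (F n)) - star f) 2 (vectorMeasure π y)) atTop
      (𝓝 0) := by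
    refine (hle (Measure.le_add_left le_rfl)).congr fun n => ?_
    refine eLpNorm_congr_norm_ae (ae_of_all _ fun a => ?_)
    simp only [Pi.sub_apply, ContinuousMap.star_apply, Pi.star_apply]
    rw [← star_sub, norm_star]
  refine tendsto_nhds_unique h1 ?_
  simp_rw [inner_map_left]
  exact tendsto_const_nhds.inner (tendsto_map_apply hys h2)

variable (π) in
/-- The operator `f(A)` with domain `{x | f ∈ L²(μ_x)}`. -/
def spectralOperator (f : X → ℂ) : H →ₗ.[ℂ] H where
  domain :=
    { carrier := {x | MemLp f 2 (vectorMeasure π x)}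
      zero_mem' := by
        have h : vectorMeasure π (0 : H) = 0 := by
          simpa using vectorMeasure_smul π 0 (0 : H)
        change MemLp f 2 (vectorMeasure π (0 : H))
        rw [h]
        exact ⟨aestronglyMeasurable_zero_measure f, by simp⟩
      add_mem' := memLp_vectorMeasure_add
      smul_mem' := fun c _ hx => memLp_vectorMeasure_smul c hx }
  toFun :=
    { toFun := fun x => spectralVector π x f
      map_add' := fun x y => spectralVector_add_left x.2 y.2
      map_smul' := fun c x => spectralVector_smul_left c x.2 }

theorem mem_spectralOperator_domain :
    x ∈ (spectralOperator π f).domain ↔ MemLp f 2 (vectorMeasure π x) := Iff.rfl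

theorem spectralOperator_apply (x : (spectralOperator π f).domain) :
    spectralOperator π f x = spectralVector π x f := rfl

end SpectralIntegral

/-! ### The projection valued measure on the line -/

section SpectralMeasureOfHom

variable {X : Type*} [MetricSpace X] [CompactSpace X] [MeasurableSpace X] [BorelSpace X]
  {H : Type*} [NormedAddCommGroup H] [InnerProductSpace ℂ H] [CompleteSpace H]
  {π : C(X, ℂ) →⋆ₐ[ℂ] (H →L[ℂ] H)} {f : X → ℂ} {C : ℝ}

omit [MetricSpace X] [CompactSpace X] [BorelSpace X] in
theorem memLp_two_of_bounded {μ : Measure X} [IsFiniteMeasure μ] (hf : Measurable f)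
    (hC : ∀ a, ‖f a‖ ≤ C) : MemLp f 2 μ :=
  MemLp.of_bound hf.aestronglyMeasurable C (ae_of_all _ hC)

theorem norm_spectralVector_le (hf : Measurable f) (hC : ∀ a, ‖f a‖ ≤ C) (h0 : 0 ≤ C) (x : H) :
    ‖spectralVector π x f‖ ≤ C * ‖x‖ := by
  have h1 : ‖x‖ = (eLpNorm (fun _ : X => (1 : ℂ)) 2 (vectorMeasure π x)).toReal := by
    rw [← norm_spectralVector (memLp_const _), spectralVector_one]
  rw [norm_spectralVector (memLp_two_of_bounded hf hC), h1, ← ENNReal.toReal_ofReal h0,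
    ← ENNReal.toReal_mul]
  refine ENNReal.toReal_mono (ENNReal.mul_ne_top ENNReal.ofReal_ne_top (memLp_const _).2.ne) ?_
  exact eLpNorm_le_mul_eLpNorm_of_ae_le_mul (ae_of_all _ fun a => by simpa using hC a) 2

variable (π) in
/-- The bounded operator attached to a bounded measurable function. -/
def spectralCLM (f : X → ℂ) (hf : Measurable f) (hC : ∀ a, ‖f a‖ ≤ C) (h0 : 0 ≤ C) : H →L[ℂ] H :=
  LinearMap.mkContinuous
    { toFun := fun x => spectralVector π x f
      map_add' := fun _ _ => spectralVector_add_left (memLp_two_of_bounded hf hC)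
        (memLp_two_of_bounded hf hC)
      map_smul' := fun c _ => spectralVector_smul_left c (memLp_two_of_bounded hf hC) } C
    (norm_spectralVector_le hf hC h0)

theorem spectralCLM_apply (hf : Measurable f) (hC : ∀ a, ‖f a‖ ≤ C) (h0 : 0 ≤ C) (x : H) :
    spectralCLM π f hf hC h0 x = spectralVector π x f := rfl

variable {κ : X → ℝ}

/-- The indicator function of the preimage of a set. -/
def preimageIndicator (κ : X → ℝ) (B : Set ℝ) : X → ℂ := (κ ⁻¹' B).indicator fun _ => 1

omit [MetricSpace X] [CompactSpace X] [BorelSpace X] in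
theorem measurable_preimageIndicator (hκ : Measurable κ) {B : Set ℝ} (hB : MeasurableSet B) :
    Measurable (preimageIndicator κ B) :=
  measurable_const.indicator (hκ hB)

omit [MetricSpace X] [CompactSpace X] [MeasurableSpace X] [BorelSpace X] in
theorem norm_preimageIndicator_le (B : Set ℝ) (a : X) : ‖preimageIndicator κ B a‖ ≤ 1 := by
  rw [preimageIndicator]
  refine (norm_indicator_le_norm_self _ _).trans ?_
  simp

omit [MetricSpace X] [CompactSpace X] [BorelSpace X] in
theorem memLp_preimageIndicator (hκ : Measurable κ) {B : Set ℝ} (hB : MeasurableSet B)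
    {μ : Measure X} [IsFiniteMeasure μ] : MemLp (preimageIndicator κ B) 2 μ :=
  memLp_two_of_bounded (measurable_preimageIndicator hκ hB) (norm_preimageIndicator_le B)

omit [MetricSpace X] [CompactSpace X] [MeasurableSpace X] [BorelSpace X] in
theorem preimageIndicator_mul (B D : Set ℝ) :
    preimageIndicator κ B * preimageIndicator κ D = preimageIndicator κ (B ∩ D) := by
  ext a
  by_cases hB : κ a ∈ B <;> by_cases hD : κ a ∈ D <;> simp [preimageIndicator, hB, hD]

omit [MetricSpace X] [CompactSpace X] [MeasurableSpace X] [BorelSpace X] in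
theorem star_preimageIndicator (B : Set ℝ) :
    star (preimageIndicator κ B) = preimageIndicator κ B := by
  ext a
  by_cases h : a ∈ κ ⁻¹' B <;> simp [preimageIndicator, h]

theorem ofReal_norm_sq_preimageIndicator (hκ : Measurable κ) {B : Set ℝ} (hB : MeasurableSet B)
    (x : H) : ENNReal.ofReal (‖spectralVector π x (preimageIndicator κ B)‖ ^ 2)
      = vectorMeasure π x (κ ⁻¹' B) := by
  rw [eLpNorm_spectralVector (memLp_preimageIndicator hκ hB), ← lintegral_indicator_one (hκ hB)]
  refine lintegral_congr fun a => ?_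
  by_cases h : a ∈ κ ⁻¹' B <;> simp [preimageIndicator, h]

/-- The error of a finite partial sum is the `L²` norm of the indicator of the omitted sets, at most
the square root of the tail of a convergent series of measures. -/
theorem hasSum_preimageIndicator (hκ : Measurable κ) {B : ℕ → Set ℝ}
    (hB : ∀ n, MeasurableSet (B n)) (hd : Pairwise (Function.onFun Disjoint B)) (x : H) :
    HasSum (fun n => spectralVector π x (preimageIndicator κ (B n)))
      (spectralVector π x (preimageIndicator κ (⋃ n, B n))) := by
  set μ := vectorMeasure π x with hμ
  have hsum : ∀ s : Finset ℕ, ∑ n ∈ s, preimageIndicator κ (B n)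
      = preimageIndicator κ (⋃ n ∈ s, B n) := by
    intro s
    have h1 := Finset.indicator_biUnion s (fun n => κ ⁻¹' B n) (f := fun _ : X => (1 : ℂ))
      (fun i _ j _ hij => (hd hij).preimage κ)
    rw [preimageIndicator, preimage_iUnion₂, h1]
    ext a
    simp [preimageIndicator]
  have hms : ∀ s : Finset ℕ, MeasurableSet (⋃ n ∈ s, B n) := fun s =>
    s.measurableSet_biUnion fun n _ => hB n
  have hvec : ∀ s : Finset ℕ, ∑ n ∈ s, spectralVector π x (preimageIndicator κ (B n))
      = spectralVector π x (preimageIndicator κ (⋃ n ∈ s, B n)) := by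
    intro s
    rw [← hsum]
    induction s using Finset.cons_induction with
    | empty =>
      simp only [Finset.sum_empty]
      rw [← norm_eq_zero.1 (le_antisymm ((norm_spectralVector_le (π := π) (f := (0 : X → ℂ))
        measurable_const (C := 0) (by simp) le_rfl x).trans (by simp)) (norm_nonneg _))]
    | cons n s hn ih =>
      rw [Finset.sum_cons, Finset.sum_cons, ih, spectralVector_add
        (memLp_preimageIndicator hκ (hB n))]
      rw [hsum]
      exact memLp_preimageIndicator hκ (hms s)
  rw [HasSum]
  simp only [SummationFilter.unconditional_filter]
  simp_rw [hvec]
  refine tendsto_spectralVector (memLp_preimageIndicator hκ (.iUnion hB))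
    (fun s => memLp_preimageIndicator hκ (hms s)) ?_
  have hfin : ∑' n, μ (κ ⁻¹' B n) ≠ ⊤ := by
    rw [← measure_iUnion (fun i j hij => (hd hij).preimage κ) fun n => hκ (hB n)]
    exact measure_ne_top _ _
  have ht := (ENNReal.tendsto_tsum_compl_atTop_zero hfin)
  have hle : ∀ s : Finset ℕ,
      eLpNorm (preimageIndicator κ (⋃ n ∈ s, B n) - preimageIndicator κ (⋃ n, B n)) 2 μ
        ≤ (∑' n : { n // n ∉ s }, μ (κ ⁻¹' B n)) ^ (1 / 2 : ℝ) := by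
    intro s
    have h1 : eLpNorm (preimageIndicator κ (⋃ n ∈ s, B n) - preimageIndicator κ (⋃ n, B n)) 2 μ
        = eLpNorm ((⋃ n : { n // n ∉ s }, κ ⁻¹' B n).indicator fun _ => (1 : ℂ)) 2 μ := by
      refine eLpNorm_congr_norm_ae (ae_of_all _ fun a => ?_)
      simp only [preimageIndicator, Pi.sub_apply, indicator]
      by_cases h : ∃ n, κ a ∈ B n
      · obtain ⟨n, hn⟩ := h
        have huniq : ∀ m, κ a ∈ B m → m = n := fun m hm => by
          by_contra hmn
          exact (Set.disjoint_left.1 (hd hmn)) hm hn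
        by_cases hs : n ∈ s
        · have e1 : a ∈ κ ⁻¹' ⋃ n ∈ s, B n := mem_iUnion₂.2 ⟨n, hs, hn⟩
          have e2 : a ∈ κ ⁻¹' ⋃ n, B n := mem_iUnion.2 ⟨n, hn⟩
          have e3 : a ∉ ⋃ n : { n // n ∉ s }, κ ⁻¹' B n := by
            rw [mem_iUnion]
            rintro ⟨m, hm⟩
            exact m.2 (huniq m hm ▸ hs)
          rw [if_pos e1, if_pos e2, if_neg e3, sub_self]
        · have e1 : a ∉ κ ⁻¹' ⋃ n ∈ s, B n := by
            rw [mem_preimage, mem_iUnion₂]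
            rintro ⟨m, hm, hm'⟩
            exact hs (huniq m hm' ▸ hm)
          have e2 : a ∈ κ ⁻¹' ⋃ n, B n := mem_iUnion.2 ⟨n, hn⟩
          have e3 : a ∈ ⋃ n : { n // n ∉ s }, κ ⁻¹' B n := mem_iUnion.2 ⟨⟨n, hs⟩, hn⟩
          rw [if_neg e1, if_pos e2, if_pos e3, zero_sub, norm_neg]
      · push Not at h
        simp [h]
    have hm : MeasurableSet (⋃ n : { n // n ∉ s }, κ ⁻¹' B n) := .iUnion fun n => hκ (hB n)
    rw [h1, eLpNorm_indicator_const (c := (1 : ℂ)) (p := 2) hm (by simp) (by simp)]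
    simp only [enorm_one, one_mul, ENNReal.toReal_ofNat]
    gcongr
    exact measure_iUnion_le _
  refine tendsto_of_tendsto_of_tendsto_of_le_of_le tendsto_const_nhds ?_ (fun _ => zero_le) hle
  simpa [Function.comp_def] using
    (ENNReal.continuous_rpow_const (y := (1 / 2 : ℝ))).tendsto 0 |>.comp ht

open Classical in
variable (π) in
/-- The spectral measure obtained by pushing forward the functional calculus along `κ`. -/
def spectralMeasureOfHom (hκ : Measurable κ) : SpectralMeasure H where
  proj B := if hB : MeasurableSet B then
    spectralCLM π (preimageIndicator κ B) (measurable_preimageIndicator hκ hB)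
      (norm_preimageIndicator_le B) zero_le_one else 0
  not_measurable B hB := dif_neg hB
  isStarProjection B hB := by
    rw [dif_pos hB]
    refine ⟨?_, ?_⟩
    · ext x
      change spectralVector π (spectralVector π x _) _ = spectralVector π x _
      rw [spectralVector_spectralVector (measurable_preimageIndicator hκ hB)
        (memLp_preimageIndicator hκ hB) (measurable_preimageIndicator hκ hB),
        preimageIndicator_mul, inter_self]
      rw [preimageIndicator_mul, inter_self]
      exact memLp_preimageIndicator hκ hB
    · rw [ContinuousLinearMap.isSelfAdjoint_iff_isSymmetric]
      intro x y
      change ⟪spectralVector π x _, y⟫_ℂ = ⟪x, spectralVector π y _⟫_ℂ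
      rw [inner_spectralVector_left (memLp_preimageIndicator hκ hB)
        (memLp_preimageIndicator hκ hB), star_preimageIndicator]
  univ := by
    rw [dif_pos .univ]
    ext x
    change spectralVector π x _ = x
    conv_rhs => rw [← spectralVector_one (π := π) x]
    congr 1
    ext a
    simp [preimageIndicator]
  inter B D hB hD := by
    rw [dif_pos hB, dif_pos hD, dif_pos (hB.inter hD)]
    ext x
    change spectralVector π x _ = spectralVector π (spectralVector π x _) _
    rw [spectralVector_spectralVector (measurable_preimageIndicator hκ hD)
        (memLp_preimageIndicator hκ hD) (measurable_preimageIndicator hκ hB),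
        preimageIndicator_mul]
    rw [preimageIndicator_mul]
    exact memLp_preimageIndicator hκ (hB.inter hD)
  iUnion B hB hd x := by
    simp only [dif_pos (MeasurableSet.iUnion hB), dif_pos (hB _)]
    exact hasSum_preimageIndicator hκ hB hd x

theorem spectralMeasureOfHom_proj (hκ : Measurable κ) {B : Set ℝ} (hB : MeasurableSet B) (x : H) :
    (spectralMeasureOfHom π hκ).proj B x = spectralVector π x (preimageIndicator κ B) := by
  rw [spectralMeasureOfHom]
  simp only [dif_pos hB]
  rfl

theorem spectralMeasureOfHom_measure (hκ : Measurable κ) (x : H) :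
    (spectralMeasureOfHom π hκ).measure x = (vectorMeasure π x).map κ := by
  ext B hB
  rw [SpectralMeasure.measure, Measure.ofMeasurable_apply _ hB, Measure.map_apply hκ hB,
    spectralMeasureOfHom_proj hκ hB, ofReal_norm_sq_preimageIndicator hκ hB]

theorem isIntegral_spectralOperator (hκ : Measurable κ) {f : ℝ → ℝ} (hf : Measurable f) :
    (spectralMeasureOfHom π hκ).IsIntegral f (spectralOperator π fun a => (f (κ a) : ℂ)) := by
  refine ⟨fun x => ?_, fun x => ?_⟩
  · rw [mem_spectralOperator_domain, spectralMeasureOfHom_measure,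
      memLp_map_measure_iff hf.aestronglyMeasurable hκ.aemeasurable]
    exact ⟨fun h => h.re, fun h => h.ofReal⟩
  · rw [spectralOperator_apply, inner_self_spectralVector x.2, spectralMeasureOfHom_measure,
      integral_map hκ.aemeasurable hf.aestronglyMeasurable, integral_complex_ofReal]

end SpectralMeasureOfHom

/-! ### The spectral theorem via the resolvent -/

section SpectralTheorem

variable {H : Type*} [NormedAddCommGroup H] [InnerProductSpace ℂ H] {A : H →ₗ.[ℂ] H}

theorem eq_of_add_smul_I_eq (hA : A.IsFormalAdjoint A) {σ : ℝ} (hσ : σ ^ 2 = 1) {x y : A.domain}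
    (h : A x + (Complex.I * σ) • (x : H) = A y + (Complex.I * σ) • (y : H)) : x = y := by
  have h1 := norm_sq_add_smul_I hA hσ (x - y)
  have h2 : A (x - y) + (Complex.I * σ) • ((x - y : A.domain) : H) = 0 := by
    rw [LinearPMap.map_sub, AddSubgroupClass.coe_sub, smul_sub]
    rw [← sub_eq_zero] at h
    rw [← h]
    abel
  rw [h2] at h1
  have h3 : ‖((x - y : A.domain) : H)‖ = 0 := by
    have := norm_nonneg ((x - y : A.domain) : H)
    simp only [norm_zero] at h1
    nlinarith [sq_nonneg ‖A (x - y)‖]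
  rw [norm_eq_zero] at h3
  exact sub_eq_zero.1 (Subtype.ext h3)

/-- The resolvent of a symmetric operator at an imaginary unit. -/
theorem exists_resolvent (hA : A.IsFormalAdjoint A) {σ : ℝ} (hσ : σ ^ 2 = 1)
    (hs : ∀ y : H, ∃ x : A.domain, A x + (Complex.I * σ) • (x : H) = y) :
    ∃ R : H →L[ℂ] H, ∀ y : H, ∃ x : A.domain, (x : H) = R y ∧
      A x + (Complex.I * σ) • (x : H) = y := by
  choose f hf using hs
  let L : H →ₗ[ℂ] H :=
    { toFun := fun y => f y
      map_add' := fun y z => by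
        rw [← Submodule.coe_add, Subtype.coe_inj]
        refine eq_of_add_smul_I_eq hA hσ ?_
        rw [hf, LinearPMap.map_add, Submodule.coe_add, smul_add]
        conv_lhs => rw [← hf y, ← hf z]
        abel
      map_smul' := fun c y => by
        rw [RingHom.id_apply, ← Submodule.coe_smul, Subtype.coe_inj]
        refine eq_of_add_smul_I_eq hA hσ ?_
        rw [hf, LinearPMap.map_smul, Submodule.coe_smul, smul_comm _ c, ← smul_add, hf] }
  refine ⟨L.mkContinuous 1 fun y => ?_, fun y => ⟨f y, rfl, hf y⟩⟩
  have h1 := norm_sq_add_smul_I hA hσ (f y)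
  rw [hf] at h1
  rw [one_mul]
  exact abs_le_of_sq_le_sq' (by change ‖(f y : H)‖ ^ 2 ≤ _; nlinarith [sq_nonneg ‖A (f y)‖])
    (norm_nonneg _) |>.2

variable [CompleteSpace H]
  {X : Type*} [MetricSpace X] [CompactSpace X] [MeasurableSpace X] [BorelSpace X]
  {π : C(X, ℂ) →⋆ₐ[ℂ] (H →L[ℂ] H)}

theorem spectralOperator_symmetric {κ : X → ℝ} :
    (spectralOperator π fun a => (κ a : ℂ)).IsFormalAdjoint
      (spectralOperator π fun a => (κ a : ℂ)) := by
  intro x y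
  rw [spectralOperator_apply, spectralOperator_apply, inner_spectralVector_left x.2 y.2]
  congr 2
  ext a
  simp

/-- With `u` the indicator of the zero set, `ζ * u = 0`, so `π ζ` kills the vector attached to `u`.
That vector vanishes by injectivity, and its squared norm is the measure of the zero set. -/
theorem ae_ne_zero_of_injective {ζ : C(X, ℂ)} (h : Function.Injective (π ζ)) (y : H) :
    ∀ᵐ a ∂(vectorMeasure π y), ζ a ≠ 0 := by
  have hZ : MeasurableSet {a | ζ a = 0} := (isClosed_eq ζ.continuous continuous_const).measurableSet
  set u : X → ℂ := {a | ζ a = 0}.indicator fun _ => 1 with hu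
  have hm : MemLp u 2 (vectorMeasure π y) := (memLp_const _).indicator hZ
  have h0 : ⇑ζ * u = ⇑(0 : C(X, ℂ)) := by
    ext a
    by_cases ha : ζ a = 0 <;> simp [hu, ha]
  have h1 : spectralVector π y u = 0 := by
    apply h
    rw [map_spectralVector ζ hm, h0, spectralVector_continuousMap]
    simp
  have h2 := eLpNorm_spectralVector hm
  have h3 : ∀ a, ‖u a‖ₑ ^ 2 = {a | ζ a = 0}.indicator 1 a := fun a => by
    by_cases ha : ζ a = 0 <;> simp [hu, ha]
  rw [h1, lintegral_congr h3, lintegral_indicator_one hZ] at h2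
  rw [ae_iff]
  simpa using h2.symm

/-- A symmetric operator with resolvent `π ζ`, where `ζ` takes values in the image of the real
line under `r ↦ (r + i)⁻¹` and its closure, is the multiplication by `r`. -/
theorem eq_spectralOperator_of_resolvent (hA : A.IsFormalAdjoint A) {ζ : C(X, ℂ)}
    (hζ : ∀ a, (ζ a).im = -‖ζ a‖ ^ 2) (hinj : Function.Injective (π ζ))
    (hR : ∀ y : H, ∃ x : A.domain, (x : H) = π ζ y ∧ A x + (Complex.I * (1 : ℝ)) • (x : H) = y) :
    A = spectralOperator π fun a => (((ζ a)⁻¹.re : ℝ) : ℂ) := by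
  set κ : X → ℂ := fun a => (((ζ a)⁻¹.re : ℝ) : ℂ) with hκ
  have hζm : Measurable ζ := ζ.continuous.measurable
  have hκm : Measurable κ := Complex.measurable_ofReal.comp (Complex.measurable_re.comp hζm.inv)
  have hb : ∀ a, ‖(κ * ⇑ζ) a‖ ≤ 1 := fun a => by
    by_cases h : ζ a = 0
    · simp [h]
    rw [Pi.mul_apply, norm_mul, hκ, Complex.norm_real]
    calc ‖(ζ a)⁻¹.re‖ * ‖ζ a‖ ≤ ‖(ζ a)⁻¹‖ * ‖ζ a‖ := by gcongr; exact Complex.abs_re_le_norm _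
      _ = 1 := by rw [norm_inv, inv_mul_cancel₀ (norm_ne_zero_iff.2 h)]
  -- The hypothesis on `ζ` says that `ζ⁻¹` has imaginary part `1` where `ζ ≠ 0`, so there `κ = ζ⁻¹ -
  -- i`. This mirrors `A R = 1 - i R` for the resolvent `R`.
  have hmul : ∀ a, ζ a ≠ 0 → (κ * ⇑ζ) a = ((fun _ => 1 : X → ℂ) - Complex.I • ⇑ζ) a := fun a h => by
    have him : (ζ a)⁻¹.im = 1 := by
      rw [Complex.inv_im, hζ, neg_neg, Complex.normSq_eq_norm_sq, div_self]
      exact pow_ne_zero _ (norm_ne_zero_iff.2 h)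
    have : κ a = (ζ a)⁻¹ - Complex.I := by
      apply Complex.ext <;> simp [hκ, him]
    rw [Pi.mul_apply, this, Pi.sub_apply, Pi.smul_apply, sub_mul, inv_mul_cancel₀ h]
    rfl
  have hbm : ∀ y, MemLp (κ * ⇑ζ) 2 (vectorMeasure π y) := fun y =>
    memLp_two_of_bounded (hκm.mul hζm) hb
  have hval : ∀ y, MemLp κ 2 (vectorMeasure π (π ζ y)) ∧
      spectralVector π (π ζ y) κ = y - Complex.I • π ζ y := fun y => by
    have hc := memLp_continuousMap (vectorMeasure π y) ζ
    rw [← spectralVector_continuousMap, spectralVector_spectralVector hζm hc hκm (hbm y)]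
    refine ⟨(memLp_vectorMeasure_spectralVector hζm hc hκm).2 (hbm y), ?_⟩
    rw [spectralVector_congr ((ae_ne_zero_of_injective hinj y).mono hmul),
      spectralVector_sub (memLp_const _) (hc.const_smul _), spectralVector_one,
      spectralVector_const_smul _ hc]
  have hval' : ∀ x : A.domain, MemLp κ 2 (vectorMeasure π (x : H)) ∧
      spectralVector π (x : H) κ = A x := fun x => by
    obtain ⟨x', h1, h2⟩ := hR (A x + (Complex.I * (1 : ℝ)) • (x : H))
    obtain rfl := eq_of_add_smul_I_eq hA (by norm_num) h2
    have h3 := hval (A x' + (Complex.I * (1 : ℝ)) • (x' : H))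
    rw [← h1] at h3
    simpa using h3
  have hle : A ≤ spectralOperator π κ := by
    refine ⟨fun x hx => (hval' ⟨x, hx⟩).1, fun {x y} hxy => ?_⟩
    rw [spectralOperator_apply, ← hxy, (hval' x).2]
  -- No proper symmetric extension exists: `A + i` is already onto, while the extension plus `i` is
  -- injective.
  refine LinearPMap.eq_of_le_of_domain_eq hle (le_antisymm hle.1 fun w hw => ?_)
  obtain ⟨x, -, hx⟩ := hR (spectralOperator π κ ⟨w, hw⟩ + (Complex.I * (1 : ℝ)) • w)
  have h1 : (⟨x, hle.1 x.2⟩ : (spectralOperator π κ).domain) = ⟨w, hw⟩ := by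
    refine eq_of_add_smul_I_eq (σ := 1) spectralOperator_symmetric (by norm_num) ?_
    rw [← hle.2 (x := x) (y := ⟨x, hle.1 x.2⟩) rfl]
    exact hx
  have h2 : (x : H) = w := congrArg Subtype.val h1
  exact h2 ▸ x.2

/-- The spectral theorem for self-adjoint operators: every such operator is given by a real
function in a functional calculus. -/
theorem exists_eq_spectralOperator (hA : A.IsFormalAdjoint A)
    (hs : ∀ σ : ℝ, σ ^ 2 = 1 → ∀ y : H, ∃ x : A.domain, A x + (Complex.I * σ) • (x : H) = y) :
    ∃ (R : H →L[ℂ] H) (π : C(spectrum ℂ R, ℂ) →⋆ₐ[ℂ] (H →L[ℂ] H)) (κ : spectrum ℂ R → ℝ),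
      Measurable κ ∧ A = spectralOperator π fun a => (κ a : ℂ) := by
  obtain ⟨R, hR⟩ := exists_resolvent hA (σ := 1) (by norm_num) (hs 1 (by norm_num))
  obtain ⟨R', hR'⟩ := exists_resolvent hA (σ := -1) (by norm_num) (hs (-1) (by norm_num))
  have hRA : ∀ x : A.domain, R (A x + Complex.I • (x : H)) = x := fun x => by
    obtain ⟨x', h1, h2⟩ := hR (A x + (Complex.I * (1 : ℝ)) • (x : H))
    obtain rfl := eq_of_add_smul_I_eq hA (by norm_num) h2
    simpa using h1.symm
  have hRA' : ∀ x : A.domain, R' (A x - Complex.I • (x : H)) = x := fun x => by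
    obtain ⟨x', h1, h2⟩ := hR' (A x + (Complex.I * (-1 : ℝ)) • (x : H))
    obtain rfl := eq_of_add_smul_I_eq hA (by norm_num) h2
    simpa [sub_eq_add_neg] using h1.symm
  -- The resolvent identity in both orders shows that `R` commutes with `R' = star R`, so `R` is
  -- normal and has a continuous functional calculus.
  have e1 : R - R' = -(2 * Complex.I) • (R * R') := by
    ext y
    obtain ⟨x, h1, h2⟩ := hR' y
    have h3 : R y = x - (2 * Complex.I) • R x := by
      have h4 : y = A x + Complex.I • (x : H) - (2 * Complex.I) • (x : H) := by
        rw [← h2]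
        push_cast
        module
      rw [h4, map_sub, hRA, map_smul]
    rw [sub_apply, h3, smul_apply, mul_apply_eq_comp, ← h1]
    module
  have e2 : R - R' = -(2 * Complex.I) • (R' * R) := by
    ext y
    obtain ⟨x, h1, h2⟩ := hR y
    have h3 : R' y = x + (2 * Complex.I) • R' x := by
      have h4 : y = A x - Complex.I • (x : H) + (2 * Complex.I) • (x : H) := by
        rw [← h2]
        push_cast
        module
      rw [h4, map_add, hRA', map_smul]
    rw [sub_apply, h3, smul_apply, mul_apply_eq_comp, ← h1]
    module
  have hstar : star R = R' := by
    rw [ContinuousLinearMap.star_eq_adjoint, eq_comm, ContinuousLinearMap.eq_adjoint_iff]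
    intro y z
    obtain ⟨x, h1, h2⟩ := hR' y
    obtain ⟨w, h3, h4⟩ := hR z
    have h5 : ⟪A x, (w : H)⟫_ℂ = ⟪(x : H), A w⟫_ℂ := hA x w
    rw [← h1, ← h3, ← h2, ← h4, inner_add_left, inner_add_right, inner_smul_left, inner_smul_right,
      h5]
    simp
  have hI : -(2 * Complex.I) ≠ 0 := by simp
  have hcomm : R' * R = R * R' := smul_right_injective _ hI (e2.symm.trans e1)
  have hn : IsStarNormal R := ⟨by rw [hstar]; exact hcomm⟩
  set ζ : C(spectrum ℂ R, ℂ) := (ContinuousMap.id ℂ).restrict (spectrum ℂ R) with hζ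
  have hπ : cfcHom hn ζ = R := cfcHom_id hn
  -- The resolvent identity read on the spectrum; it says that `Im ζ = -|ζ| ^ 2`.
  have hrel : ζ - star ζ = -(2 * Complex.I) • (ζ * star ζ) := by
    apply cfcHom_injective hn
    rw [map_sub, map_smul, map_mul, map_star, hπ, hstar, e1]
  refine ⟨R, cfcHom hn, fun a => (ζ a)⁻¹.re, ?_, ?_⟩
  · exact Complex.measurable_re.comp ζ.continuous.measurable.inv
  · refine eq_spectralOperator_of_resolvent hA (fun a => ?_) ?_ ?_
    · have h1 := congrArg (fun g : C(spectrum ℂ R, ℂ) => (g a).im) hrel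
      simp [Complex.mul_conj, Complex.normSq_eq_norm_sq] at h1
      rw [← Complex.ofReal_pow, Complex.ofReal_re] at h1
      linarith
    · rw [hπ]
      intro y z hyz
      obtain ⟨x, h1, h2⟩ := hR y
      obtain ⟨w, h3, h4⟩ := hR z
      have : x = w := Subtype.ext (by rw [h1, h3, hyz])
      rw [← h2, ← h4, this]
    · rw [hπ]
      exact hR

end SpectralTheorem

/-! ### Solutions of `u' = A u` and the exponential of `A` -/

section Exponential

theorem hasDerivAt_of_norm_le_sq {F : Type*} [NormedAddCommGroup F] [NormedSpace ℝ F] {f : ℝ → F}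
    {f' : F} {x C : ℝ} (hf : ∀ᶠ h in 𝓝 0, ‖f (x + h) - f x - h • f'‖ ≤ C * h ^ 2) :
    HasDerivAt f f' x := by
  rw [hasDerivAt_iff_isLittleO_nhds_zero]
  have h1 : (fun h => f (x + h) - f x - h • f') =O[𝓝 0] fun h : ℝ => h ^ 2 :=
    Asymptotics.IsBigO.of_bound C (hf.mono fun h hh => by simpa using hh)
  exact h1.trans_isLittleO (Asymptotics.isLittleO_pow_id one_lt_two)

variable {X : Type*} [MetricSpace X] [CompactSpace X] [MeasurableSpace X] [BorelSpace X]
  {H : Type*} [NormedAddCommGroup H] [InnerProductSpace ℂ H] [CompleteSpace H]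
  {π : C(X, ℂ) →⋆ₐ[ℂ] (H →L[ℂ] H)} {κ : X → ℝ}

/-- The function `exp(s κ)`. -/
def expFunction (κ : X → ℝ) (s : ℝ) (a : X) : ℂ := (Real.exp (s * κ a) : ℂ)

omit [MetricSpace X] [CompactSpace X] [BorelSpace X] in
theorem measurable_expFunction (hκ : Measurable κ) (s : ℝ) : Measurable (expFunction κ s) :=
  Complex.measurable_ofReal.comp (Real.measurable_exp.comp (hκ.const_mul s))

omit [MetricSpace X] [CompactSpace X] [MeasurableSpace X] [BorelSpace X] in
theorem norm_preimageIndicator_mul_le {B : Set ℝ} {g : X → ℂ} {C : ℝ} (h0 : 0 ≤ C)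
    (h : ∀ a, κ a ∈ B → ‖g a‖ ≤ C) (a : X) : ‖(preimageIndicator κ B * g) a‖ ≤ C := by
  by_cases ha : κ a ∈ B
  · simpa [preimageIndicator, ha] using h a ha
  · simpa [preimageIndicator, ha] using h0

omit [MetricSpace X] [CompactSpace X] [MeasurableSpace X] [BorelSpace X] in
theorem norm_expFunction_le {n s : ℝ} {a : X} (ha : κ a ∈ Icc (-n) n) :
    ‖expFunction κ s a‖ ≤ Real.exp (|s| * n) := by
  rw [expFunction, Complex.norm_real, Real.norm_eq_abs, Real.abs_exp, Real.exp_le_exp]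
  refine (le_abs_self _).trans ?_
  rw [abs_mul]
  gcongr
  exact abs_le.2 ha

omit [MetricSpace X] [CompactSpace X] [BorelSpace X] in
theorem memLp_preimageIndicator_mul (hκ : Measurable κ) {B : Set ℝ} (hB : MeasurableSet B)
    {g : X → ℂ} (hg : Measurable g) {C : ℝ} (h0 : 0 ≤ C) (h : ∀ a, κ a ∈ B → ‖g a‖ ≤ C)
    {μ : Measure X} [IsFiniteMeasure μ] : MemLp (preimageIndicator κ B * g) 2 μ :=
  memLp_two_of_bounded ((measurable_preimageIndicator hκ hB).mul hg)
    (norm_preimageIndicator_mul_le h0 h)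

omit [MetricSpace X] [CompactSpace X] [BorelSpace X] in
theorem memLp_cutoff_expFunction (hκ : Measurable κ) (n s : ℝ) {μ : Measure X} [IsFiniteMeasure μ] :
    MemLp (preimageIndicator κ (Icc (-n) n) * expFunction κ s) 2 μ :=
  memLp_preimageIndicator_mul hκ measurableSet_Icc (measurable_expFunction hκ s)
    (Real.exp_pos _).le fun _ => norm_expFunction_le

omit [MetricSpace X] [CompactSpace X] [BorelSpace X] in
theorem memLp_cutoff_mul_expFunction (hκ : Measurable κ) {n : ℝ} (hn : 0 ≤ n) (s : ℝ)
    {μ : Measure X} [IsFiniteMeasure μ] :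
    MemLp (preimageIndicator κ (Icc (-n) n) * ((fun a => (κ a : ℂ)) * expFunction κ s)) 2 μ :=
  memLp_preimageIndicator_mul hκ measurableSet_Icc
    ((Complex.measurable_ofReal.comp hκ).mul (measurable_expFunction hκ s))
    (mul_nonneg hn (Real.exp_pos (|s| * n)).le) fun a ha => by
      rw [Pi.mul_apply, norm_mul]
      gcongr
      · exact (Complex.norm_real _).trans_le (abs_le.2 ha)
      · exact norm_expFunction_le ha

/-- On the cutoff region `|κ| ≤ n`, so `|exp x - 1 - x| ≤ x ^ 2` with `x = h * κ a` and `|h| * n <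
1` gives a uniform quadratic remainder. -/
theorem hasDerivAt_cutoff_exp (hκ : Measurable κ) {n : ℝ} (hn : 0 ≤ n) (z : H) (s : ℝ) :
    HasDerivAt (fun s => spectralVector π z (preimageIndicator κ (Icc (-n) n) * expFunction κ s))
      (spectralVector π z
        (preimageIndicator κ (Icc (-n) n) * ((fun a => (κ a : ℂ)) * expFunction κ s))) s := by
  refine hasDerivAt_of_norm_le_sq (C := Real.exp (|s| * n) * n ^ 2 * ‖z‖) ?_
  have hev : ∀ᶠ h : ℝ in 𝓝 0, |h| * n < 1 :=
    (Continuous.tendsto' (by fun_prop) _ _ (by simp)).eventually_lt_const one_pos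
  filter_upwards [hev] with h hh
  have hm := fun s => memLp_cutoff_expFunction hκ n s (μ := vectorMeasure π z)
  have hm' := memLp_cutoff_mul_expFunction hκ hn s (μ := vectorMeasure π z)
  have hb := (measurable_preimageIndicator hκ (measurableSet_Icc (a := -n) (b := n)))
  rw [← spectralVector_sub (hm _) (hm _), ← Complex.coe_smul, ← spectralVector_const_smul _ hm',
    ← spectralVector_sub ((hm _).sub (hm _)) (hm'.const_smul _), ← mul_sub, ← mul_smul_comm,
    ← mul_sub]
  have hC : 0 ≤ Real.exp (|s| * n) * n ^ 2 * h ^ 2 := by positivity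
  refine (norm_spectralVector_le (C := Real.exp (|s| * n) * n ^ 2 * h ^ 2) ?_ ?_ hC z).trans
    (le_of_eq (by ring))
  · exact hb.mul (((measurable_expFunction hκ _).sub (measurable_expFunction hκ _)).sub
      (((Complex.measurable_ofReal.comp hκ).mul (measurable_expFunction hκ _)).const_smul _))
  · refine norm_preimageIndicator_mul_le hC fun a ha => ?_
    have h1 : (expFunction κ (s + h) - expFunction κ s - (h : ℂ) • ((fun a => (κ a : ℂ)) *
        expFunction κ s)) a = expFunction κ s a * ((Real.exp (h * κ a) - 1 - h * κ a : ℝ) : ℂ) := by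
      simp only [expFunction, Pi.sub_apply, Pi.smul_apply, Pi.mul_apply, smul_eq_mul, add_mul,
        Real.exp_add]
      push_cast
      ring
    have h2 : |h * κ a| ≤ |h| * n := by
      rw [abs_mul]
      gcongr
      exact abs_le.2 ha
    rw [h1, norm_mul, mul_assoc]
    gcongr
    · exact norm_expFunction_le ha
    · rw [Complex.norm_real]
      refine (Real.abs_exp_sub_one_sub_id_le (h2.trans hh.le)).trans ?_
      rw [← sq_abs (h * κ a), ← sq_abs h, ← mul_pow, mul_comm n]
      gcongr

/-- Pair `u s` with the cutoff of `e^{(t-s)A} z`. By symmetry of `A` the two terms of the derivative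
in `s` cancel, and comparing `s = 0` with `s = t` for all `z` gives the identity. -/
theorem cutoff_apply_solution (hκ : Measurable κ) {a b t : ℝ} (h0 : 0 ∈ Ioo a b) (ht : t ∈ Ioo a b)
    {u v : ℝ → H} (hu : ∀ s ∈ Ioo a b, HasDerivAt u (v s) s)
    (hA : ∀ s ∈ Ioo a b, ∃ hs : u s ∈ (spectralOperator π fun a => (κ a : ℂ)).domain,
      spectralOperator π (fun a => (κ a : ℂ)) ⟨u s, hs⟩ = v s) {n : ℝ} (hn : 0 ≤ n) :
    spectralVector π (u t) (preimageIndicator κ (Icc (-n) n))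
      = spectralVector π (u 0) (preimageIndicator κ (Icc (-n) n) * expFunction κ t) := by
  set F : ℝ → X → ℂ := fun s => preimageIndicator κ (Icc (-n) n) * expFunction κ s with hF
  have hκc : Measurable fun a => (κ a : ℂ) := Complex.measurable_ofReal.comp hκ
  have hFm : ∀ s, Measurable (F s) := fun s =>
    (measurable_preimageIndicator hκ measurableSet_Icc).mul (measurable_expFunction hκ s)
  have hFL : ∀ s z, MemLp (F s) 2 (vectorMeasure π z) := fun s z => memLp_cutoff_expFunction hκ n s
  have hFκ : ∀ s, (fun a => (κ a : ℂ)) * F s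
      = preimageIndicator κ (Icc (-n) n) * ((fun a => (κ a : ℂ)) * expFunction κ s) := fun s =>
    mul_left_comm _ _ _
  have hstar : ∀ s, star (F s) = F s := fun s => by
    rw [hF, star_mul', star_preimageIndicator]
    congr 1
    ext a
    exact Complex.conj_ofReal _
  have hF0 : F 0 = preimageIndicator κ (Icc (-n) n) := by
    ext a
    simp [hF, expFunction]
  suffices spectralVector π (u t) (F 0) = spectralVector π (u 0) (F t) by rwa [hF0] at this
  refine ext_inner_left ℂ fun z => ?_
  have hd : ∀ s ∈ Ioo a b,
      HasDerivAt (fun s => ⟪spectralVector π z (F (t - s)), u s⟫_ℂ) 0 s := fun s hs => by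
    obtain ⟨hus, hAu⟩ := hA s hs
    have h1 := ((hasDerivAt_cutoff_exp (π := π) hκ hn z (t - s)).scomp s
      ((hasDerivAt_id s).const_sub t)).inner ℂ (hu s hs)
    refine h1.congr_deriv ?_
    have h2 : MemLp (fun a => (κ a : ℂ)) 2 (vectorMeasure π (spectralVector π z (F (t - s)))) := by
      rw [memLp_vectorMeasure_spectralVector (hFm _) (hFL _ _) hκc, hFκ]
      exact memLp_cutoff_mul_expFunction hκ hn _
    have h3 := spectralOperator_symmetric (π := π) (κ := κ) ⟨_, h2⟩ ⟨_, hus⟩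
    rw [spectralOperator_apply, hAu, spectralVector_spectralVector (hFm _) (hFL _ _) hκc, hFκ] at h3
    · change ⟪spectralVector π z (F (t - s)), v s⟫_ℂ + _ = 0
      rw [← h3, neg_one_smul, inner_neg_left]
      exact add_neg_cancel _
    · rw [hFκ]
      exact memLp_cutoff_mul_expFunction hκ hn _
  have hc := isOpen_Ioo.is_const_of_deriv_eq_zero isPreconnected_Ioo
    (fun s hs => (hd s hs).differentiableAt.differentiableWithinAt)
    (fun s hs => (hd s hs).deriv) ht h0
  simp only [sub_self, sub_zero] at hc
  rw [inner_spectralVector_left (hFL _ _) (hFL _ _), inner_spectralVector_left (hFL _ _) (hFL _ _),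
    hstar, hstar] at hc
  exact hc

theorem eq_zero_of_cutoff_eq_zero (hκ : Measurable κ) {w : H}
    (h : ∀ n : ℕ, spectralVector π w (preimageIndicator κ (Icc (-(n : ℝ)) n)) = 0) : w = 0 := by
  have h1 : ∀ n : ℕ, vectorMeasure π w (κ ⁻¹' Icc (-(n : ℝ)) n) = 0 := fun n => by
    rw [← ofReal_norm_sq_preimageIndicator hκ measurableSet_Icc, h n]
    simp
  have h2 : (univ : Set X) = ⋃ n : ℕ, κ ⁻¹' Icc (-(n : ℝ)) n := by
    ext a
    obtain ⟨n, hn⟩ := exists_nat_ge |κ a|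
    simpa using ⟨n, abs_le.1 hn⟩
  have h3 : vectorMeasure π w = 0 := by
    rw [← Measure.measure_univ_eq_zero, h2]
    exact measure_iUnion_null h1
  rw [← norm_eq_zero, ← spectralVector_one (π := π) w, norm_spectralVector (memLp_const _), h3]
  simp

/-- A solution of `u' = A u` is given by the exponential of `A`. -/
theorem exp_apply_solution (hκ : Measurable κ) {a b t : ℝ} (h0 : 0 ∈ Ioo a b) (ht : t ∈ Ioo a b)
    {u v : ℝ → H} (hu : ∀ s ∈ Ioo a b, HasDerivAt u (v s) s)
    (hA : ∀ s ∈ Ioo a b, ∃ hs : u s ∈ (spectralOperator π fun a => (κ a : ℂ)).domain,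
      spectralOperator π (fun a => (κ a : ℂ)) ⟨u s, hs⟩ = v s) :
    ∃ h : u 0 ∈ (spectralOperator π (expFunction κ t)).domain,
      spectralOperator π (expFunction κ t) ⟨u 0, h⟩ = u t := by
  have hcut := fun n : ℕ => cutoff_apply_solution hκ h0 ht hu hA (Nat.cast_nonneg n)
  have hm : MemLp (expFunction κ t) 2 (vectorMeasure π (u 0)) := by
    refine ⟨(measurable_expFunction hκ t).aestronglyMeasurable, ?_⟩
    -- Fatou: the cutoffs converge pointwise to `exp(tκ)`, and their `L²` norms equal those of the
    -- cutoffs of `u t`, hence are at most `‖u t‖`.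
    refine lt_of_le_of_lt (Lp.eLpNorm_lim_le_liminf_eLpNorm
      (f := fun n : ℕ => preimageIndicator κ (Icc (-(n : ℝ)) n) * expFunction κ t)
      (fun n => (memLp_cutoff_expFunction hκ n t).1) _ (ae_of_all _ fun a => ?_)) ?_
    · obtain ⟨N, hN⟩ := exists_nat_ge |κ a|
      refine tendsto_const_nhds.congr' ?_
      filter_upwards [eventually_ge_atTop N] with n hn
      have h1 : κ a ∈ Icc (-(n : ℝ)) n := abs_le.1 (hN.trans (by exact_mod_cast hn))
      simp only [preimageIndicator, Pi.mul_apply]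
      rw [indicator_of_mem (by exact h1), one_mul]
    · have h2 : ∀ n : ℕ, eLpNorm (preimageIndicator κ (Icc (-(n : ℝ)) n) * expFunction κ t) 2
          (vectorMeasure π (u 0)) ≤ ENNReal.ofReal ‖u t‖ := fun n => by
        have hL := memLp_cutoff_expFunction hκ n t (μ := vectorMeasure π (u 0))
        rw [← ENNReal.ofReal_toReal hL.2.ne, ← norm_spectralVector hL, ← hcut]
        refine ENNReal.ofReal_le_ofReal ((norm_spectralVector_le
          (measurable_preimageIndicator hκ measurableSet_Icc) (norm_preimageIndicator_le _)
          zero_le_one _).trans (one_mul _).le)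
      refine lt_of_le_of_lt (liminf_le_liminf (v := fun _ => ENNReal.ofReal ‖u t‖)
        (Eventually.of_forall h2)) ?_
      simp
  refine ⟨hm, ?_⟩
  rw [spectralOperator_apply, ← sub_eq_zero]
  refine eq_zero_of_cutoff_eq_zero hκ (π := π) fun n => ?_
  have hI : Measurable (preimageIndicator κ (Icc (-(n : ℝ)) n)) :=
    measurable_preimageIndicator hκ measurableSet_Icc
  rw [← spectralCLM_apply hI (norm_preimageIndicator_le _) zero_le_one, map_sub, spectralCLM_apply,
    spectralCLM_apply, hcut, spectralVector_spectralVector (measurable_expFunction hκ t) hm hI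
    (memLp_cutoff_expFunction hκ n t), sub_self]

end Exponential

/-! ### The Lie derivative as an unbounded operator -/

section LieOperator

variable {E : Type*} [NormedAddCommGroup E] [NormedSpace ℝ E]
  {M : Type*} [TopologicalSpace M] [ChartedSpace E M]
  {H : Type*} [NormedAddCommGroup H] [InnerProductSpace ℂ H] [CompleteSpace H] [RKHS ℂ H M ℂ]
  {V : (m : M) → TangentSpace 𝓘(ℝ, E) m}

theorem inner_fieldDerivative_kernelVector
    (hk : ContMDiff 𝓘(ℝ, E) 𝓘(ℝ, H) ∞ (kernelVector (M := M) H)) {K : M → M → ℂ}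
    (hH : HasKernel H K) (hV : IsKernelSymmetric K V) (m n : M) :
    ⟪fieldDerivative V (kernelVector (M := M) H) n, kernelVector H m⟫_ℂ
      = ⟪kernelVector H n, fieldDerivative V (kernelVector (M := M) H) m⟫_ℂ := by
  have hK : ∀ m, (fun x => K x m) = (kernelVector H m : H) := fun m => funext fun x => (hH m x).symm
  have h := hV m n
  rw [hK, hK, lieDerivative_coe V hk, lieDerivative_coe V hk, inner_conj_symm] at h
  exact h

theorem mem_lieOperator_domain (hk : ContMDiff 𝓘(ℝ, E) 𝓘(ℝ, H) ∞ (kernelVector (M := M) H))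
    {φ ψ : H}
    (h : ∀ m, ⟪kernelVector H m, ψ⟫_ℂ = ⟪fieldDerivative V (kernelVector (M := M) H) m, φ⟫_ℂ) :
    φ ∈ (lieOperator H V).domain :=
  ⟨contMDiff_coe_of_contMDiff_kernelVector hk φ, ψ, funext fun m => by
    rw [← kernelVector_inner, h, lieDerivative_coe V hk]⟩

theorem kernelVector_inner_lieOperator
    (hk : ContMDiff 𝓘(ℝ, E) 𝓘(ℝ, H) ∞ (kernelVector (M := M) H)) (m : M)
    (φ : (lieOperator H V).domain) : ⟪kernelVector H m, lieOperator H V φ⟫_ℂ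
      = ⟪fieldDerivative V (kernelVector (M := M) H) m, (φ : H)⟫_ℂ := by
  rw [kernelVector_inner, coe_lieOperator_apply, lieDerivative_coe V hk]

omit [CompleteSpace H] [RKHS ℂ H M ℂ] in
theorem domRestrict_apply_eq {T : H →ₗ.[ℂ] H} {S : Submodule ℂ H} (x : (T.domRestrict S).domain) :
    T.domRestrict S x = T ⟨x, x.2.2⟩ := LinearPMap.domRestrict_apply rfl

/-- The derivative of the kernel along `V` is symmetric. -/
def IsSymmetricAlong (H : Type*) [NormedAddCommGroup H] [InnerProductSpace ℂ H] [CompleteSpace H]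
    [RKHS ℂ H M ℂ] (V : (m : M) → TangentSpace 𝓘(ℝ, E) m) : Prop :=
  ContMDiff 𝓘(ℝ, E) 𝓘(ℝ, H) ∞ (kernelVector (M := M) H) ∧
  ∀ m n : M, ⟪fieldDerivative V (kernelVector (M := M) H) n, kernelVector H m⟫_ℂ
      = ⟪kernelVector H n, fieldDerivative V (kernelVector (M := M) H) m⟫_ℂ

variable (hs : IsSymmetricAlong H V)

include hs

theorem kernelVector_mem_domain (m : M) : kernelVector H m ∈ (lieOperator H V).domain :=
  mem_lieOperator_domain hs.1 fun n => (hs.2 m n).symm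

/-- Symmetry moves the derivative from the evaluation point `n` to the index `m`. Consequently `m ↦
K_m` restricted to an integral curve solves `u' = A u`. -/
theorem lieOperator_kernelVector (m : M) (h : kernelVector H m ∈ (lieOperator H V).domain) :
    lieOperator H V ⟨kernelVector H m, h⟩ = fieldDerivative V (kernelVector (M := M) H) m := by
  refine DFunLike.ext _ _ fun n => ?_
  rw [← kernelVector_inner, kernelVector_inner_lieOperator hs.1, hs.2, kernelVector_inner]

theorem kernelSpan_le_domain : kernelSpan H ≤ (lieOperator H V).domain := by
  rw [kernelSpan, Submodule.span_le]
  rintro _ ⟨m, rfl⟩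
  exact kernelVector_mem_domain hs m

theorem kernelVector_mem_domRestrict (m : M) :
    kernelVector H m ∈ ((lieOperator H V).domRestrict (kernelSpan H)).domain :=
  ⟨Submodule.subset_span ⟨m, rfl⟩, kernelVector_mem_domain hs m⟩

theorem domRestrict_kernelVector (m : M)
    (h : kernelVector H m ∈ ((lieOperator H V).domRestrict (kernelSpan H)).domain) :
    (lieOperator H V).domRestrict (kernelSpan H) ⟨kernelVector H m, h⟩
      = fieldDerivative V (kernelVector (M := M) H) m := by
  rw [domRestrict_apply_eq,
    lieOperator_kernelVector hs]

theorem dense_domRestrict_domain :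
    Dense (((lieOperator H V).domRestrict (kernelSpan H)).domain : Set H) := by
  rw [LinearPMap.domRestrict_domain, inf_eq_left.2 (kernelSpan_le_domain hs)]
  exact kernelSpan_dense

/-- On a kernel vector both sides are the pairing of `y` with the derivative of `K_m` along `V`;
linearity extends this to the span. -/
theorem isFormalAdjoint_domRestrict :
    ((lieOperator H V).domRestrict (kernelSpan H)).IsFormalAdjoint (lieOperator H V) := by
  intro x y
  rw [domRestrict_apply_eq]
  obtain ⟨x, hx, hx'⟩ := x
  change ⟪lieOperator H V ⟨x, hx'⟩, (y : H)⟫_ℂ = ⟪x, lieOperator H V y⟫_ℂ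
  have hle := kernelSpan_le_domain hs
  induction hx using Submodule.span_induction with
  | mem x hx =>
    obtain ⟨m, rfl⟩ := hx
    rw [lieOperator_kernelVector hs, kernelVector_inner_lieOperator hs.1]
  | zero =>
    rw [inner_zero_left]
    change ⟪lieOperator H V 0, (y : H)⟫_ℂ = 0
    rw [LinearPMap.map_zero, inner_zero_left]
  | add a b ha hb iha ihb =>
    rw [inner_add_left, ← iha (hle ha), ← ihb (hle hb), ← inner_add_left, ← LinearPMap.map_add]
    rfl
  | smul c a ha iha =>
    rw [inner_smul_left, ← iha (hle ha), ← inner_smul_left, ← LinearPMap.map_smul]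
    rfl

theorem symmetric_domRestrict : ((lieOperator H V).domRestrict (kernelSpan H)).IsFormalAdjoint
    ((lieOperator H V).domRestrict (kernelSpan H)) := fun x y => by
  rw [domRestrict_apply_eq y]
  exact isFormalAdjoint_domRestrict hs x ⟨y, y.2.2⟩

/-- Testing the adjoint relation `T† φ = ψ` on kernel vectors says pointwise that `ψ` is the Lie
derivative of `φ`, which is exactly membership in the maximal domain. -/
theorem adjoint_domRestrict :
    ((lieOperator H V).domRestrict (kernelSpan H)).adjoint = lieOperator H V := by
  have hd := dense_domRestrict_domain hs
  have hle := (isFormalAdjoint_domRestrict hs).le_adjoint hd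
  refine (LinearPMap.eq_of_le_of_domain_eq hle (le_antisymm hle.1 fun φ hφ => ?_)).symm
  refine mem_lieOperator_domain hs.1
    (ψ := ((lieOperator H V).domRestrict (kernelSpan H)).adjoint ⟨φ, hφ⟩) fun m => ?_
  have h := LinearPMap.adjoint_isFormalAdjoint hd ⟨φ, hφ⟩
    ⟨kernelVector H m, kernelVector_mem_domRestrict hs m⟩
  rw [domRestrict_kernelVector hs] at h
  rw [← inner_conj_symm, h, inner_conj_symm]

variable [CompleteSpace E] [IsManifold 𝓘(ℝ, E) ∞ M]

theorem hasTrivialDeficiency_domRestrict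
    (hV : ContMDiff 𝓘(ℝ, E) 𝓘(ℝ, E).tangent ∞ (fun m => (⟨m, V m⟩ : TangentBundle 𝓘(ℝ, E) M))) :
    HasTrivialDeficiency ((lieOperator H V).domRestrict (kernelSpan H)) := by
  intro σ hσ φ hφ
  refine DFunLike.ext _ _ fun m => ?_
  have : IsManifold 𝓘(ℝ, E) 1 M := .of_le (n := ∞) (by simp)
  obtain ⟨γ, hγ0, hγ⟩ := exists_isMIntegralCurveAt_of_contMDiffAt_boundaryless 0
    ((hV.of_le (by simp)).contMDiffAt (x := m))
  obtain ⟨ε, hε, hγ⟩ := isMIntegralCurveAt_iff'.1 hγ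
  rw [Real.ball_eq_Ioo, zero_sub, zero_add] at hγ
  have hsm : ∀ n, ContMDiff 𝓘(ℝ, E) 𝓘(ℝ, H) ∞
      ((fieldDerivative V)^[n] (kernelVector (M := M) H)) := fun n => by
    induction n with
    | zero => exact hs.1
    | succ n ih =>
      rw [Function.iterate_succ_apply']
      exact contMDiff_fieldDerivative hV ih
  -- The higher derivatives of `K_{γ t}` are iterated derivatives of the kernel vectors along `V`.
  -- They need not lie in the span; only symmetry of the first derivative is used.
  have h := inner_eq_zero_of_symmetric_flow (φ := φ) (σ := σ)
    (u := fun n t => (fieldDerivative V)^[n] (kernelVector (M := M) H) (γ t)) hε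
    (fun n t ht => by
      rw [Function.iterate_succ_apply']
      exact hasDerivAt_comp_integralCurve (hsm n) ht hγ)
    (fun s _ t _ => hs.2 (γ t) (γ s)) hσ (fun t _ => by
      have h1 := hφ ⟨kernelVector H (γ t), kernelVector_mem_domRestrict hs _⟩
      rw [domRestrict_kernelVector hs] at h1
      exact h1)
  rw [← kernelVector_inner, RKHS.coe_zero, Pi.zero_apply, ← inner_conj_symm, ← hγ0]
  exact (congrArg _ h).trans (map_zero _)

end LieOperator

end GeometricFroehlich

end

/-! ### Assembly of the theorem -/

theorem theoremT
    {E : Type*} [NormedAddCommGroup E] [NormedSpace ℝ E] [CompleteSpace E]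
    {M : Type*} [TopologicalSpace M] [ChartedSpace E M] [IsManifold 𝓘(ℝ, E) ∞ M]
    (K : M → M → ℂ)
    (hKsmooth : ContMDiff (𝓘(ℝ, E).prod 𝓘(ℝ, E)) 𝓘(ℝ, ℂ) ∞ (fun p : M × M => K p.1 p.2))
    (hKpos : GeometricFroehlich.IsPositiveDefiniteKernel K)
    {H : Type*} [NormedAddCommGroup H] [InnerProductSpace ℂ H] [CompleteSpace H]
    [RKHS ℂ H M ℂ] (hH : GeometricFroehlich.HasKernel H K) :
    (∀ φ : H, ContMDiff 𝓘(ℝ, E) 𝓘(ℝ, ℂ) ∞ (φ : M → ℂ)) ∧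
    ∀ V : (m : M) → TangentSpace 𝓘(ℝ, E) m,
      ContMDiff 𝓘(ℝ, E) 𝓘(ℝ, E).tangent ∞ (fun m => (⟨m, V m⟩ : TangentBundle 𝓘(ℝ, E) M)) →
      GeometricFroehlich.IsKernelSymmetric K V →
      GeometricFroehlich.kernelSpan H ≤ (GeometricFroehlich.lieOperator H V).domain ∧
      GeometricFroehlich.IsEssentiallySelfAdjoint
        ((GeometricFroehlich.lieOperator H V).domRestrict (GeometricFroehlich.kernelSpan H)) ∧
      ((GeometricFroehlich.lieOperator H V).domRestrict
        (GeometricFroehlich.kernelSpan H)).closure = GeometricFroehlich.lieOperator H V ∧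
      ∀ t : ℝ, ∃ S : H →ₗ.[ℂ] H,
        GeometricFroehlich.IsExponential
          ((GeometricFroehlich.lieOperator H V).domRestrict
            (GeometricFroehlich.kernelSpan H)).closure t S ∧
        ∀ m n : M, GeometricFroehlich.FlowsTo V t m n →
          ∃ hm : GeometricFroehlich.kernelVector H m ∈ S.domain,
            S ⟨GeometricFroehlich.kernelVector H m, hm⟩ =
              GeometricFroehlich.kernelVector H n := by
  open GeometricFroehlich in
  have hk : ContMDiff 𝓘(ℝ, E) 𝓘(ℝ, H) ∞ (kernelVector (M := M) H) :=
    contMDiff_kernelVector hKsmooth hH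
  refine ⟨contMDiff_coe_of_contMDiff_kernelVector hk, fun V hV hKV => ?_⟩
  have hs : IsSymmetricAlong H V := ⟨hk, inner_fieldDerivative_kernelVector hk hH hKV⟩
  have hd := dense_domRestrict_domain hs
  have hT := symmetric_domRestrict hs
  have hdef := hasTrivialDeficiency_domRestrict hs hV
  have hcl : ((lieOperator H V).domRestrict (kernelSpan H)).closure = lieOperator H V :=
    (closure_eq_adjoint hd hT hdef).trans (adjoint_domRestrict hs)
  refine ⟨kernelSpan_le_domain hs, isEssentiallySelfAdjoint_of_hasTrivialDeficiency hd hT hdef,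
    hcl, fun t => ?_⟩
  obtain ⟨R, π, κ, hκ, hA⟩ := exists_eq_spectralOperator (closure_symmetric hd hT hdef)
    fun σ hσ => exists_closure_add_smul_eq hd hT hdef hσ
  refine ⟨spectralOperator π (expFunction κ t), ⟨spectralMeasureOfHom π hκ, ?_, ?_⟩, ?_⟩
  · rw [hA]
    exact isIntegral_spectralOperator hκ measurable_id
  · exact isIntegral_spectralOperator hκ (Real.measurable_exp.comp (measurable_const_mul t))
  · rintro m n ⟨a, b, γ, h0, ht, hγ, rfl, rfl⟩
    rw [hcl] at hA
    -- The domain condition holds because each `K_{γ s}` is a kernel vector, and the derivative of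
    -- the curve is the operator applied to it.
    refine exp_apply_solution (u := fun s => kernelVector H (γ s)) hκ h0 ht
      (fun s hs => hasDerivAt_comp_integralCurve hk hs hγ) fun s _ => ?_
    rw [← hA]
    exact ⟨kernelVector_mem_domain hs _, lieOperator_kernelVector hs _ _⟩
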